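/- Let $q\in\mathbb{C}$ with $0<|q|<1$. Put $(x)_\infty=\prod_{j\ge 0}(1-xq^j)$ and, for $i\in\mathbb{Z}$, $(x)_i=(x)_\infty/(xq^i)_\infty$, read as the finite product $(x)_i=\prod_{j=0}^{i-1}(1-xq^j)$ for $i\ge 0$ and $(x)_{-i}=\prod_{j=1}^{i}(1-xq^{-j})^{-1}$ for $i>0$. Let $${}_{r+1}\phi_r\left({a,b_1,\dots,b_r\atop c_1,\dots,c_r};q,x\right)=\sum_{k=0}^\infty\frac{(a)_k(b_1)_k\cdots(b_r)_k}{(q)_k(c_1)_k\cdots(c_r)_k}x^k .$$ Let $r,s,n_1,\dots,n_r\in\mathbb{Z}_{\ge0}$, $N=n_1+\cdots+n_r$, and let $a,b,c_1,\dots,c_r\in\mathbb{C}$ with $a\neq0$ and $c_j\notin\{q^{-k}:k\ge0\}$ for all $j$. In (i), (ii) and (iv) below assume also $b\ne 0$. (i) If $b\notin\{q^{-k}:k\ge1\}$ and $|a^{-1}q^{1-N-s}|<1$, then $${}_{r+2}\phi_{r+1}\left({a,b,c_1q^{n_1},\dots,c_rq^{n_r}\atop bq,c_1,\dots,c_r};q,a^{-1}q^{1-N-s}\right)=\frac{(q)_\infty(bq/a)_\infty(c_1/b)_{n_1}\cdots(c_r/b)_{n_r}}{(q/a)_\infty(bq)_\infty(c_1)_{n_1}\cdots(c_r)_{n_r}}\,b^{N+s}.$$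 (ii) If $b\notin\{q^{-k}:k\ge0\}$, $c_j\neq0$ and $s\le n_j$ for all $j$, and $|a^{-1}q^{1-N+s+\min\{r-2,0\}s}|<1$, then $$\sum_{i=0}^s\frac{(q^{-s})_i}{(q)_i}q^{si}\frac{(q^{1-i}/a)_\infty\prod_{j=1}^r(q^{1-n_j}/c_j)_{n_j-i}}{(q)_\infty(1/b)_{1-i}}\;{}_{r+2}\phi_{r+1}\left({aq^i,bq^i,c_1q^{n_1},\dots,c_rq^{n_r}\atop bq,c_1q^i,\dots,c_rq^i};q,a^{-1}q^{1-N+s+(r-2)i}\right)=-\frac{(bq/a)_\infty\prod_{j=1}^r(bq^{1-n_j}/c_j)_{n_j}}{(b)_\infty}\,b^{1-s}.$$ (iii) If $|a^{-1}q^{-N-s}|<1$, then $${}_{r+1}\phi_r\left({a,c_1q^{n_1},\dots,c_rq^{n_r}\atop c_1,\dots,c_r};q,a^{-1}q^{-N-s}\right)=0.$$ (iv) If $b\notin\{q^{-k}:k\ge0\}$, $c_j\neq0$ and $s\le n_j$ for all $j$, and $|a^{-1}q^{-N+s+\min\{r-2,0\}s}|<1$, then $$\sum_{i=0}^s\frac{(q^{-s})_i}{(q)_i}q^{si}\frac{(q^{1-i}/a)_\infty\prod_{j=1}^r(q^{1-n_j}/c_j)_{n_j-i}}{(q/b)_{-i}}\;{}_{r+2}\phi_{r+1}\left({aq^i,bq^i,c_1q^{n_1},\dots,c_rq^{n_r}\atop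 b,c_1q^i,\dots,c_rq^i};q,a^{-1}q^{-N+s+(r-2)i}\right)=0.$$ In each case all the series that occur converge absolutely. -/

import Mathlib

noncomputable section

namespace BasicHyp

open Finset

/-- The infinite `q`-shifted factorial `(a; q)_∞ = ∏_{j ≥ 0} (1 - a q ^ j)`. -/
def qPochInf (a q : ℂ) : ℂ := ∏' j : ℕ, (1 - a * q ^ j)

/-- The `q`-shifted factorial `(a; q)_i` for an integer `i`, as a finite product:
`(a; q)_i = (1 - a) (1 - a q) ⋯ (1 - a q ^ (i - 1))` for `i ≥ 0` and
`(a; q)_{-i} = 1 / ((1 - a q ^ (-1)) ⋯ (1 - a q ^ (-i)))` for `i > 0`.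
It is the quotient `(a; q)_∞ / (a q ^ i; q)_∞` whenever the latter is not `0 / 0`
(see `qPoch_natCast_eq_div` and `qPoch_neg_natCast_eq_div`), and it also covers cases such as
`(q ^ (-s); q)_i`, where that quotient has to be read in the cancelled form. -/
def qPoch (a q : ℂ) : ℤ → ℂ
  | Int.ofNat n => ∏ j ∈ range n, (1 - a * q ^ j)
  | Int.negSucc n => (∏ j ∈ range (n + 1), (1 - a * q ^ (-((j : ℤ) + 1))))⁻¹

/-- The `k`-th term of the basic hypergeometric series
`_{r+1}φ_r (a, b_1, …, b_r; c_1, …, c_r; q, x)`. -/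
def phiTerm {r : ℕ} (a : ℂ) (b c : Fin r → ℂ) (q x : ℂ) (k : ℕ) : ℂ :=
  (qPoch a q k * ∏ j, qPoch (b j) q k) / (qPoch q q k * ∏ j, qPoch (c j) q k) * x ^ k

/-- The basic hypergeometric series `_{r+1}φ_r (a, b_1, …, b_r; c_1, …, c_r; q, x)`. -/
def phi {r : ℕ} (a : ℂ) (b c : Fin r → ℂ) (q x : ℂ) : ℂ :=
  ∑' k : ℕ, phiTerm a b c q x k

theorem qPochInf_split {q : ℂ} (hq : ‖q‖ < 1) (a : ℂ) (n : ℕ) :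
    qPochInf a q = qPoch a q n * qPochInf (a * q ^ (n : ℤ)) q := by
  have hm (b : ℂ) : Multipliable fun j : ℕ => 1 - b * q ^ j := by
    have : Summable fun j : ℕ => ‖-(b * q ^ j)‖ := by
      simp only [norm_neg, norm_mul, norm_pow]
      exact (summable_geometric_of_lt_one (norm_nonneg _) hq).mul_left _
    simpa [sub_eq_add_neg] using multipliable_one_add_of_summable this
  have h2 : (fun j : ℕ => 1 - a * q ^ (j + n)) = fun j : ℕ => 1 - a * q ^ n * q ^ j := by
    funext j; ring
  have h := Multipliable.prod_mul_tprod_nat_mul' (f := fun j : ℕ => 1 - a * q ^ j) (k := n)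
    (by rw [h2]; exact hm _)
  rw [h2] at h
  simpa [qPochInf, qPoch] using h.symm

theorem qPoch_natCast_eq_div {q : ℂ} (hq : ‖q‖ < 1) (a : ℂ) (n : ℕ)
    (h : qPochInf (a * q ^ (n : ℤ)) q ≠ 0) :
    qPoch a q n = qPochInf a q / qPochInf (a * q ^ (n : ℤ)) q := by
  rw [eq_div_iff h, ← qPochInf_split hq]

theorem qPoch_neg_natCast_eq_div {q : ℂ} (hq0 : q ≠ 0) (hq : ‖q‖ < 1) (a : ℂ) (n : ℕ)
    (h : qPochInf a q ≠ 0) :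
    qPoch a q (-(n : ℤ)) = qPochInf a q / qPochInf (a * q ^ (-(n : ℤ))) q := by
  have key : qPoch a q (-(n : ℤ)) = (qPoch (a * q ^ (-(n : ℤ))) q n)⁻¹ := by
    cases n with
    | zero => simp [qPoch]
    | succ n =>
      change (∏ j ∈ range (n + 1), (1 - a * q ^ (-((j : ℤ) + 1))))⁻¹ =
        (∏ j ∈ range (n + 1), (1 - a * q ^ (-((n + 1 : ℕ) : ℤ)) * q ^ j))⁻¹
      rw [← Finset.prod_range_reflect]
      congr 1
      refine Finset.prod_congr rfl fun j hj => ?_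
      have hj' : j ≤ n := by simpa [Nat.lt_succ_iff] using hj
      rw [mul_assoc, ← zpow_natCast q j, ← zpow_add₀ hq0]
      have : -((n + 1 : ℕ) : ℤ) + (j : ℕ) = -(((n + 1 - 1 - j : ℕ) : ℤ) + 1) := by omega
      rw [this]
  have hs := qPochInf_split hq (a * q ^ (-(n : ℤ))) n
  rw [mul_assoc, ← zpow_add₀ hq0, neg_add_cancel, zpow_zero, mul_one] at hs
  rw [key, hs, div_mul_cancel_right₀ h]

end BasicHyp

end

/-!
The idea is to read every series as a `q`-binomial series with a polynomial weight. Put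
`t_m(z) = (a)_m / (q)_m z ^ m`. By the `q`-binomial theorem (`qPochInf_mul_tsum_binTerm`),
`∑ t_m(z) = (a z)_∞ / (z)_∞`, which is zero for `z = q ^ (-p) / a` with `p ≥ 0`. Hence
`∑ t_m(1 / a) V(q ^ (-m)) = 0` for every polynomial `V` whose degree is small enough for
convergence (`hasSum_binTerm_mul_eval`). Writing `V = V(b) + (X - b) Q`, this also gives
`∑ t_m(q / a) V(q ^ (-m)) / (1 - b q ^ m) = V(b) ∑ t_m(q / a) / (1 - b q ^ m)`
(`hasSum_binTerm_mul_eval_div`), and the last sum is a product by the case `c = b q` of the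
`q`-Gauss sum (`tsum_binTerm_div`). Both product formulas come from a first order contiguous
relation, iterated to the limit.

For a single series, `(c q ^ n)_k / (c)_k = (c q ^ k)_n / (c)_n` is a polynomial in `q ^ k`, so the
two facts above apply directly (`phi_eq_zero`, `phi_eq_prod`).

For a sum over `i` of series in `k`, reversing finite products shows that the `(i, k)` term depends
on `k` only through `m = k + i`, as `t_m(q ^ s / a)`, with an additional factor
`q ^ m / (1 - b q ^ m)` in the inhomogeneous case, times the value at `X = q ^ (-m)` of a polynomial
that vanishes there for `m < i` (`outer_term_eq`). So the sums over `i` and `m` may be exchanged,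
and the weight becomes the polynomial `outerPoly`, which is
`∑_i (q^{-s})_i / (q)_i q^i (X)_i (β X)_i ∏_j (d_j q^i X)_{n_j - i}`. As a power series the `i`-th
product is `B(X) A(q ^ i X)` with `A` and `B` independent of `i`, because
`(α X)_i = (α X)_∞ / (α q ^ i X)_∞`. Since `∑_i (q^{-s})_i / (q)_i q^i q^{ip} = 0` for `p < s`, the
polynomial is divisible by `X ^ s` (`X_pow_dvd_outerPoly`). Removing `X ^ s` cancels the factor
`q ^ s` in the argument, and the two facts apply again (`outer_sum_eq_zero`, `outer_sum_eq_prod`).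
In the second case only `i = 0` contributes to the value of the polynomial at `X = b`.
-/

namespace BasicHyp

open Finset Filter Topology

/-! ### Finite and infinite `q`-shifted factorials -/

@[simp]
theorem qPoch_zero (a q : ℂ) : qPoch a q 0 = 1 := rfl

theorem qPoch_natCast (a q : ℂ) (k : ℕ) : qPoch a q k = ∏ j ∈ range k, (1 - a * q ^ j) := rfl

theorem qPoch_succ (a q : ℂ) (k : ℕ) :
    qPoch a q ((k + 1 : ℕ) : ℤ) = qPoch a q k * (1 - a * q ^ k) :=
  prod_range_succ _ _

theorem qPoch_add (a q : ℂ) (m n : ℕ) :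
    qPoch a q ((m + n : ℕ) : ℤ) = qPoch a q m * qPoch (a * q ^ m) q n := by
  simp only [qPoch_natCast, prod_range_add, pow_add, mul_assoc]

theorem qPoch_succ' (a q : ℂ) (k : ℕ) :
    qPoch a q ((k + 1 : ℕ) : ℤ) = (1 - a) * qPoch (a * q) q k := by
  rw [add_comm, qPoch_add, pow_one, qPoch_natCast a q 1, prod_range_one, pow_zero, mul_one]

theorem qPoch_ne_zero {a q : ℂ} (h : ∀ k : ℕ, a * q ^ k ≠ 1) (k : ℕ) : qPoch a q k ≠ 0 :=
  prod_ne_zero_iff.2 fun j _ => sub_ne_zero.2 (h j).symm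

theorem qPoch_eq_zero {a q : ℂ} {j k : ℕ} (hj : j < k) (h : a * q ^ j = 1) : qPoch a q k = 0 :=
  prod_eq_zero (mem_range.2 hj) (by rw [h, sub_self])

theorem summable_norm_neg_mul_pow {q : ℂ} (hq : ‖q‖ < 1) (a : ℂ) :
    Summable fun j : ℕ => ‖-(a * q ^ j)‖ := by
  simp only [norm_neg, norm_mul, norm_pow]
  exact (summable_geometric_of_lt_one (norm_nonneg _) hq).mul_left _

theorem tendsto_qPoch {q : ℂ} (hq : ‖q‖ < 1) (a : ℂ) :
    Tendsto (fun k : ℕ => qPoch a q k) atTop (𝓝 (qPochInf a q)) := by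
  have : Multipliable fun j : ℕ => 1 - a * q ^ j := by
    simpa [sub_eq_add_neg] using
      multipliable_one_add_of_summable (summable_norm_neg_mul_pow hq a)
  exact this.hasProd.tendsto_prod_nat

theorem qPochInf_ne_zero {a q : ℂ} (hq : ‖q‖ < 1) (h : ∀ k : ℕ, a * q ^ k ≠ 1) :
    qPochInf a q ≠ 0 := by
  have := tprod_one_add_ne_zero_of_summable (f := fun j : ℕ => -(a * q ^ j))
    (fun j => by rw [← sub_eq_add_neg]; exact sub_ne_zero.2 (h j).symm)
    (summable_norm_neg_mul_pow hq a)
  simpa [qPochInf, sub_eq_add_neg] using this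

theorem qPochInf_eq_zero {a q : ℂ} (hq : ‖q‖ < 1) {j : ℕ} (h : a * q ^ j = 1) :
    qPochInf a q = 0 := by
  rw [qPochInf_split hq a (j + 1), qPoch_eq_zero (Nat.lt_succ_self j) h, zero_mul]

theorem mul_pow_ne_one_of_norm_lt {x q : ℂ} (hq : ‖q‖ < 1) (hx : ‖x‖ < 1) (k : ℕ) :
    x * q ^ k ≠ 1 := by
  intro h
  have := congrArg norm h
  rw [norm_mul, norm_pow, norm_one] at this
  exact absurd this (mul_lt_one_of_nonneg_of_lt_one_left (norm_nonneg _) hx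
    (pow_le_one₀ (norm_nonneg _) hq.le)).ne

theorem qPoch_self_ne_zero {q : ℂ} (hq : ‖q‖ < 1) (k : ℕ) : qPoch q q k ≠ 0 :=
  qPoch_ne_zero (mul_pow_ne_one_of_norm_lt hq hq) k

theorem exists_norm_qPoch_le {q : ℂ} (hq : ‖q‖ < 1) (a : ℂ) :
    ∃ C, ∀ k : ℕ, ‖qPoch a q k‖ ≤ C := by
  obtain ⟨C, hC⟩ := (Metric.isBounded_range_of_tendsto _ (tendsto_qPoch hq a)).exists_norm_le
  exact ⟨C, fun k => hC _ ⟨k, rfl⟩⟩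

theorem exists_norm_inv_qPoch_le {a q : ℂ} (hq : ‖q‖ < 1) (h : ∀ k : ℕ, a * q ^ k ≠ 1) :
    ∃ C, ∀ k : ℕ, ‖(qPoch a q k)⁻¹‖ ≤ C := by
  obtain ⟨C, hC⟩ := (Metric.isBounded_range_of_tendsto _
    ((tendsto_qPoch hq a).inv₀ (qPochInf_ne_zero hq h))).exists_norm_le
  exact ⟨C, fun k => hC _ ⟨k, rfl⟩⟩

theorem exists_norm_inv_one_sub_le {q : ℂ} (hq : ‖q‖ < 1) (b : ℂ) :
    ∃ C, ∀ k : ℕ, ‖(1 - b * q ^ k)⁻¹‖ ≤ C := by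
  have h0 : Tendsto (fun k : ℕ => (1 - b * q ^ k)⁻¹) atTop (𝓝 (1 - b * 0)⁻¹) :=
    (tendsto_const_nhds.sub ((tendsto_pow_atTop_nhds_zero_of_norm_lt_one hq).const_mul b)).inv₀
      (by simp)
  obtain ⟨C, hC⟩ := (Metric.isBounded_range_of_tendsto _ h0).exists_norm_le
  exact ⟨C, fun k => hC _ ⟨k, rfl⟩⟩

theorem exists_norm_mul_le {f g : ℕ → ℂ} (hf : ∃ C, ∀ k, ‖f k‖ ≤ C) (hg : ∃ C, ∀ k, ‖g k‖ ≤ C) :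
    ∃ C, ∀ k, ‖f k * g k‖ ≤ C := by
  obtain ⟨C, hC⟩ := hf
  obtain ⟨D, hD⟩ := hg
  exact ⟨C * D, fun k => norm_mul_le_of_le (hC k) (hD k)⟩

theorem exists_norm_prod_le {ι : Type*} (s : Finset ι) {f : ι → ℕ → ℂ}
    (hf : ∀ i ∈ s, ∃ C, ∀ k, ‖f i k‖ ≤ C) : ∃ C, ∀ k, ‖∏ i ∈ s, f i k‖ ≤ C := by
  classical
  induction s using Finset.induction_on with
  | empty => exact ⟨1, fun k => by simp⟩
  | insert i s hi ih =>
    simp only [prod_insert hi]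
    exact exists_norm_mul_le (hf i (mem_insert_self i s))
      (ih fun j hj => hf j (mem_insert_of_mem hj))

theorem summable_mul_pow_of_norm_le {f : ℕ → ℂ} {x : ℂ} (hf : ∃ C, ∀ k, ‖f k‖ ≤ C)
    (hx : ‖x‖ < 1) : Summable fun k => f k * x ^ k := by
  obtain ⟨C, hC⟩ := hf
  refine Summable.of_norm_bounded
    ((summable_geometric_of_lt_one (norm_nonneg x) hx).mul_left C) fun k => ?_
  rw [norm_mul, norm_pow]
  exact mul_le_mul_of_nonneg_right (hC k) (by positivity)

/-- The coefficients of the series are bounded, since each `q`-shifted factorial converges and those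
in the denominator have nonzero limits. -/
theorem summable_phiTerm {r : ℕ} {a q x : ℂ} {b c : Fin r → ℂ} (hq : ‖q‖ < 1) (hx : ‖x‖ < 1)
    (hc : ∀ j (k : ℕ), c j * q ^ k ≠ 1) : Summable (phiTerm a b c q x) := by
  have key : ∃ C, ∀ k : ℕ, ‖(qPoch a q k * ∏ j, qPoch (b j) q k) *
      ((qPoch q q k)⁻¹ * ∏ j, (qPoch (c j) q k)⁻¹)‖ ≤ C :=
    exists_norm_mul_le
      (exists_norm_mul_le (exists_norm_qPoch_le hq a)
        (exists_norm_prod_le _ fun j _ => exists_norm_qPoch_le hq (b j)))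
      (exists_norm_mul_le (exists_norm_inv_qPoch_le hq (mul_pow_ne_one_of_norm_lt hq hq))
        (exists_norm_prod_le _ fun j _ => exists_norm_inv_qPoch_le hq (hc j)))
  refine (summable_mul_pow_of_norm_le key hx).congr fun k => ?_
  simp only [phiTerm, div_eq_mul_inv, mul_inv, prod_inv_distrib]

/-! ### The `q`-binomial series and its weighted variants -/

/-- The `k`-th term `(a; q)_k / (q; q)_k * z ^ k` of the `q`-binomial series `₁φ₀(a; q, z)`. -/
noncomputable def binTerm (a q z : ℂ) (k : ℕ) : ℂ := qPoch a q k / qPoch q q k * z ^ k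

theorem binTerm_zero (a q z : ℂ) : binTerm a q z 0 = 1 := by
  simp [binTerm]

theorem binTerm_mul_pow (a q z w : ℂ) (k : ℕ) :
    binTerm a q z k * w ^ k = binTerm a q (z * w) k := by
  rw [binTerm, binTerm, mul_pow, mul_assoc]

theorem binTerm_succ {q : ℂ} (hq : ‖q‖ < 1) (a z : ℂ) (k : ℕ) :
    binTerm a q z (k + 1) * (1 - q ^ (k + 1)) = binTerm a q z k * ((1 - a * q ^ k) * z) := by
  have h1 := qPoch_self_ne_zero hq k
  have h2 : 1 - q * q ^ k ≠ 0 := sub_ne_zero.2 (mul_pow_ne_one_of_norm_lt hq hq k).symm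
  rw [binTerm, binTerm, qPoch_succ, qPoch_succ, pow_succ' q k, pow_succ z k]
  generalize q * q ^ k = y at h2 ⊢
  field_simp

theorem summable_binTerm_mul {q z : ℂ} (hq : ‖q‖ < 1) (hz : ‖z‖ < 1) (a : ℂ) {g : ℕ → ℂ}
    (hg : ∃ C, ∀ k, ‖g k‖ ≤ C) : Summable fun k => binTerm a q z k * g k := by
  have key := exists_norm_mul_le (exists_norm_mul_le (exists_norm_qPoch_le hq a)
    (exists_norm_inv_qPoch_le hq (mul_pow_ne_one_of_norm_lt hq hq))) hg
  refine (summable_mul_pow_of_norm_le key hz).congr fun k => ?_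
  rw [binTerm]
  ring

theorem summable_binTerm {q z : ℂ} (hq : ‖q‖ < 1) (hz : ‖z‖ < 1) (a : ℂ) :
    Summable (binTerm a q z) := by
  simpa using summable_binTerm_mul hq hz a (g := fun _ => 1) ⟨1, by simp⟩

/-- Summation by parts for the `q`-binomial weights: the first order recurrence of `binTerm`
moves the factor `1 - q ^ k` into a shift of `g`. -/
theorem tsum_binTerm_shift {q : ℂ} (hq : ‖q‖ < 1) (a z : ℂ) (g : ℕ → ℂ)
    (hs : Summable fun k => binTerm a q z k * ((1 - q ^ k) * g k)) :
    ∑' k, binTerm a q z k * ((1 - q ^ k) * g k) =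
      ∑' k, binTerm a q z k * ((1 - a * q ^ k) * z * g (k + 1)) := by
  rw [hs.tsum_eq_zero_add]
  simp only [pow_zero, sub_self, zero_mul, mul_zero, zero_add]
  refine tsum_congr fun k => ?_
  rw [← mul_assoc, binTerm_succ hq, mul_assoc]

theorem norm_mul_pow_lt_one {q z : ℂ} (hq : ‖q‖ < 1) (hz : ‖z‖ < 1) (n : ℕ) :
    ‖z * q ^ n‖ < 1 := by
  rw [norm_mul, norm_pow]
  exact mul_lt_one_of_nonneg_of_lt_one_left (norm_nonneg _) hz
    (pow_le_one₀ (norm_nonneg _) hq.le)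

/-- Summation by parts with `g = 1`. -/
theorem tsum_binTerm_contiguous {q z : ℂ} (hq : ‖q‖ < 1) (hz : ‖z‖ < 1) (a : ℂ) :
    (1 - z) * ∑' k, binTerm a q z k = (1 - a * z) * ∑' k, binTerm a q (z * q) k := by
  have hzq : ‖z * q‖ < 1 := by simpa using norm_mul_pow_lt_one hq hz 1
  have s1 := summable_binTerm hq hz a
  have s2 := summable_binTerm hq hzq a
  have e1 : ∀ k, binTerm a q z k * ((1 - q ^ k) * 1) = binTerm a q z k - binTerm a q (z * q) k :=
    fun k => by rw [← binTerm_mul_pow]; ring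
  have e2 : ∀ k, binTerm a q z k * ((1 - a * q ^ k) * z * 1) =
      z * binTerm a q z k - a * z * binTerm a q (z * q) k :=
    fun k => by rw [← binTerm_mul_pow]; ring
  have h := tsum_binTerm_shift hq a z (fun _ => 1) (by simp only [e1]; exact s1.sub s2)
  simp only [e1, e2] at h
  rw [s1.tsum_sub s2, (s1.mul_left z).tsum_sub (s2.mul_left (a * z)), tsum_mul_left,
    tsum_mul_left] at h
  linear_combination h

/-- The `q`-binomial theorem, in the form without denominators. -/
theorem qPochInf_mul_tsum_binTerm {q z : ℂ} (hq : ‖q‖ < 1) (hz : ‖z‖ < 1) (a : ℂ) :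
    qPochInf z q * ∑' k, binTerm a q z k = qPochInf (a * z) q := by
  have step : ∀ n : ℕ, qPoch z q n * ∑' k, binTerm a q z k =
      qPoch (a * z) q n * ∑' k, binTerm a q (z * q ^ n) k := by
    intro n
    induction n with
    | zero => simp
    | succ n ih =>
      have := tsum_binTerm_contiguous hq (norm_mul_pow_lt_one hq hz n) a
      rw [mul_assoc z, ← pow_succ] at this
      rw [qPoch_succ, qPoch_succ]
      linear_combination (1 - z * q ^ n) * ih + qPoch (a * z) q n * this
  have lim : Tendsto (fun n : ℕ => ∑' k, binTerm a q (z * q ^ n) k) atTop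
      (𝓝 (∑' k, if k = 0 then 1 else 0)) := by
    refine tendsto_tsum_of_dominated_convergence (summable_binTerm hq hz a).norm (fun k => ?_)
      (Eventually.of_forall fun n k => ?_)
    · rcases Nat.eq_zero_or_pos k with rfl | hk
      · simp [binTerm_zero]
      · have : Tendsto (fun n : ℕ => binTerm a q z k * (q ^ n) ^ k) atTop
            (𝓝 (binTerm a q z k * 0 ^ k)) :=
          ((tendsto_pow_atTop_nhds_zero_of_norm_lt_one hq).pow k).const_mul _
        rw [zero_pow hk.ne', mul_zero] at this
        simpa only [binTerm_mul_pow, if_neg hk.ne'] using this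
    · rw [← binTerm_mul_pow, norm_mul]
      refine mul_le_of_le_one_right (norm_nonneg _) ?_
      rw [norm_pow, norm_pow]
      exact pow_le_one₀ (by positivity) (pow_le_one₀ (norm_nonneg _) hq.le)
  rw [tsum_ite_eq] at lim
  have h1 := (tendsto_qPoch hq z).mul_const (∑' k, binTerm a q z k)
  have h2 := (tendsto_qPoch hq (a * z)).mul lim
  simp only [step] at h1
  simpa using tendsto_nhds_unique h1 h2

/-- The `q`-binomial series vanishes at `z = q ^ (-m) / a`, `m ≥ 0`, because `(a z; q)_∞` does. -/
theorem tsum_binTerm_eq_zero {a q z : ℂ} (hq : ‖q‖ < 1) (hz : ‖z‖ < 1) {m : ℕ}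
    (h : a * z * q ^ m = 1) : ∑' k, binTerm a q z k = 0 := by
  have := qPochInf_mul_tsum_binTerm hq hz a
  rw [qPochInf_eq_zero hq h] at this
  exact (mul_eq_zero.1 this).resolve_left (qPochInf_ne_zero hq (mul_pow_ne_one_of_norm_lt hq hz))

/-- Summation by parts with `g k = b / (1 - b q ^ k)`; at the argument `q / a` the terms free of the
denominator `1 - b q ^ k` agree on both sides and cancel. -/
theorem tsum_binTerm_div_contiguous {a b q : ℂ} (hq : ‖q‖ < 1) (ha : a ≠ 0)
    (haq : ‖a⁻¹ * q‖ < 1) (hb : ∀ k : ℕ, b * q ^ k ≠ 1) :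
    (1 - b) * ∑' k, binTerm a q (a⁻¹ * q) k * (1 - b * q ^ k)⁻¹ =
      (1 - b * q / a) * ∑' k, binTerm a q (a⁻¹ * q) k * (1 - b * q * q ^ k)⁻¹ := by
  have hb' : ∀ k : ℕ, b * q * q ^ k ≠ 1 := fun k => by
    rw [mul_assoc, ← pow_succ']; exact hb (k + 1)
  have s0 := summable_binTerm hq haq a
  have s1 := summable_binTerm_mul hq haq a (exists_norm_inv_one_sub_le hq b)
  have s2 := summable_binTerm_mul hq haq a (exists_norm_inv_one_sub_le hq (b * q))
  set z := a⁻¹ * q with hz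
  have e1 : ∀ k, binTerm a q z k * ((1 - q ^ k) * (b * (1 - b * q ^ k)⁻¹)) =
      binTerm a q z k - (1 - b) * (binTerm a q z k * (1 - b * q ^ k)⁻¹) := fun k => by
    have hw := mul_inv_cancel₀ (sub_ne_zero.2 (hb k).symm)
    linear_combination binTerm a q z k * hw
  have e2 : ∀ k, binTerm a q z k * ((1 - a * q ^ k) * z * (b * (1 - b * q ^ (k + 1))⁻¹)) =
      binTerm a q z k - (1 - b * q / a) * (binTerm a q z k * (1 - b * q * q ^ k)⁻¹) := fun k => by
    have hw := mul_inv_cancel₀ (sub_ne_zero.2 (hb' k).symm)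
    have haz : a * z = q := mul_inv_cancel_left₀ ha q
    have hbz : b * q / a = b * z := by rw [hz]; ring
    rw [pow_succ', ← mul_assoc b q, hbz]
    linear_combination binTerm a q z k * hw -
      binTerm a q z k * b * q ^ k * (1 - b * q * q ^ k)⁻¹ * haz
  have h := tsum_binTerm_shift hq a z (fun k => b * (1 - b * q ^ k)⁻¹)
    (by simp only [e1]; exact s0.sub (s1.mul_left _))
  simp only [e1, e2] at h
  rw [s0.tsum_sub (s1.mul_left _), s0.tsum_sub (s2.mul_left _), tsum_mul_left,
    tsum_mul_left] at h
  linear_combination -h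

/-- The case `₂φ₁(a, b; b q; q, q / a)` of the `q`-Gauss sum. -/
theorem tsum_binTerm_div {a b q : ℂ} (hq : ‖q‖ < 1) (ha : a ≠ 0)
    (haq : ‖a⁻¹ * q‖ < 1) (hb : ∀ k : ℕ, b * q ^ k ≠ 1) :
    ∑' k, binTerm a q (a⁻¹ * q) k * (1 - b * q ^ k)⁻¹ =
      qPochInf q q * qPochInf (b * q / a) q / (qPochInf (q / a) q * qPochInf b q) := by
  have hbn : ∀ n k : ℕ, b * q ^ n * q ^ k ≠ 1 := fun n k => by
    rw [mul_assoc, ← pow_add]; exact hb (n + k)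
  set z := a⁻¹ * q with hz
  set K : ℂ → ℂ := fun x => ∑' k, binTerm a q z k * (1 - x * q ^ k)⁻¹ with hK
  have step : ∀ n : ℕ, qPoch b q n * K b = qPoch (b * q / a) q n * K (b * q ^ n) := by
    intro n
    induction n with
    | zero => simp
    | succ n ih =>
      have h := tsum_binTerm_div_contiguous (b := b * q ^ n) hq ha haq (hbn n)
      have h' : (1 - b * q ^ n) * K (b * q ^ n) =
          (1 - b * q / a * q ^ n) * K (b * q ^ (n + 1)) := by
        simp only [hK]
        rw [h, pow_succ, ← mul_assoc b]
        ring
      rw [qPoch_succ, qPoch_succ]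
      linear_combination (1 - b * q ^ n) * ih + qPoch (b * q / a) q n * h'
  have lim : Tendsto (fun n : ℕ => K (b * q ^ n)) atTop (𝓝 (∑' k, binTerm a q z k)) := by
    obtain ⟨C, hC⟩ := exists_norm_inv_one_sub_le hq b
    refine tendsto_tsum_of_dominated_convergence
      ((summable_binTerm hq haq a).norm.mul_right C) (fun k => ?_)
      (Eventually.of_forall fun n k => ?_)
    · have : Tendsto (fun n : ℕ => binTerm a q z k * (1 - b * q ^ n * q ^ k)⁻¹) atTop
          (𝓝 (binTerm a q z k * (1 - b * 0 * q ^ k)⁻¹)) :=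
        ((tendsto_const_nhds.sub (((tendsto_pow_atTop_nhds_zero_of_norm_lt_one hq).const_mul
          b).mul_const _)).inv₀ (by simp)).const_mul _
      simpa using this
    · rw [norm_mul, mul_assoc b, ← pow_add]
      exact mul_le_mul_of_nonneg_left (hC _) (norm_nonneg _)
  have h1 := (tendsto_qPoch hq b).mul_const (K b)
  have h2 := (tendsto_qPoch hq (b * q / a)).mul lim
  simp only [step] at h1
  have h3 := tendsto_nhds_unique h1 h2
  have h4 := qPochInf_mul_tsum_binTerm hq haq a
  rw [mul_inv_cancel_left₀ ha] at h4
  have n1 := qPochInf_ne_zero hq hb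
  have n2 : qPochInf z q ≠ 0 := qPochInf_ne_zero hq (mul_pow_ne_one_of_norm_lt hq haq)
  have hz' : q / a = z := by rw [hz, mul_comm, div_eq_mul_inv]
  rw [hz', eq_div_iff (mul_ne_zero n2 n1)]
  change K b * _ = _
  linear_combination qPochInf z q * h3 + qPochInf (b * q / a) q * h4

/-! ### Polynomial weights -/

/-- The coefficients of `V` may be summed separately against the series `₁φ₀(a; q, q ^ (-p) / a)`,
each of which is zero. -/
theorem hasSum_binTerm_mul_eval {a q : ℂ} (hq0 : q ≠ 0) (hq : ‖q‖ < 1) (ha : a ≠ 0)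
    (V : Polynomial ℂ) (hV : ∀ p ∈ V.support, ‖a⁻¹ * q⁻¹ ^ p‖ < 1) :
    HasSum (fun m => binTerm a q a⁻¹ m * V.eval (q⁻¹ ^ m)) 0 := by
  have key : ∀ p ∈ V.support,
      HasSum (fun m => V.coeff p * binTerm a q (a⁻¹ * q⁻¹ ^ p) m) (V.coeff p * 0) := by
    intro p hp
    have hs := (summable_binTerm hq (hV p hp) a).hasSum
    rw [tsum_binTerm_eq_zero hq (hV p hp) (m := p)
      (by rw [mul_inv_cancel_left₀ ha, ← mul_pow, inv_mul_cancel₀ hq0, one_pow])] at hs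
    exact hs.mul_left _
  have h := hasSum_sum key
  simp only [mul_zero, sum_const_zero] at h
  refine h.congr_fun fun m => ?_
  rw [Polynomial.eval_eq_sum, Polynomial.sum, mul_sum]
  refine sum_congr rfl fun p _ => ?_
  rw [← binTerm_mul_pow, ← pow_mul, ← pow_mul, mul_comm p]
  ring

/-- Writing `V = V(b) + (X - b) Q` splits the series into a multiple of the `q`-Gauss sum
and a series with polynomial weight `Q`, which vanishes. -/
theorem hasSum_binTerm_mul_eval_div {a b q : ℂ} (hq0 : q ≠ 0) (hq : ‖q‖ < 1) (ha : a ≠ 0)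
    (hb : ∀ k : ℕ, b * q ^ k ≠ 1) (V : Polynomial ℂ)
    (hV : ‖a⁻¹ * q ^ (1 - (V.natDegree : ℤ))‖ < 1) (haq : ‖a⁻¹ * q‖ < 1) :
    HasSum (fun m => binTerm a q (a⁻¹ * q) m * (V.eval (q⁻¹ ^ m) * (1 - b * q ^ m)⁻¹))
      (V.eval b * (qPochInf q q * qPochInf (b * q / a) q /
        (qPochInf (q / a) q * qPochInf b q))) := by
  obtain ⟨Q, hQ⟩ := Polynomial.X_sub_C_dvd_sub_C_eval (p := V) (a := b)
  have hsupp : ∀ p ∈ Q.support, ‖a⁻¹ * q⁻¹ ^ p‖ < 1 := by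
    intro p hp
    have hQ0 : Q ≠ 0 := by rintro rfl; simp at hp
    have hdeg : V.natDegree = 1 + Q.natDegree := by
      rw [← Polynomial.natDegree_sub_C (p := V) (a := V.eval b), hQ,
        Polynomial.natDegree_mul (Polynomial.X_sub_C_ne_zero b) hQ0, Polynomial.natDegree_X_sub_C]
    have hp' : p ≤ Q.natDegree := Polynomial.le_natDegree_of_mem_supp p hp
    refine lt_of_le_of_lt ?_ hV
    rw [norm_mul, norm_mul]
    refine mul_le_mul_of_nonneg_left ?_ (norm_nonneg _)
    rw [inv_pow, ← zpow_natCast, ← zpow_neg, norm_zpow, norm_zpow]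
    exact zpow_le_zpow_right_of_le_one₀ (norm_pos_iff.2 hq0) hq.le (by omega)
  have h1 := (summable_binTerm_mul hq haq a (exists_norm_inv_one_sub_le hq b)).hasSum
  rw [tsum_binTerm_div hq ha haq hb] at h1
  have h2 := (h1.mul_left (V.eval b)).add (hasSum_binTerm_mul_eval hq0 hq ha Q hsupp)
  rw [add_zero] at h2
  refine h2.congr_fun fun m => ?_
  have e := congrArg (Polynomial.eval (q⁻¹ ^ m)) hQ
  simp only [Polynomial.eval_sub, Polynomial.eval_mul, Polynomial.eval_X, Polynomial.eval_C] at e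
  have hqm : q⁻¹ ^ m * q ^ m = 1 := by rw [← mul_pow, inv_mul_cancel₀ hq0, one_pow]
  have hw := mul_inv_cancel₀ (sub_ne_zero.2 (hb m).symm)
  rw [← binTerm_mul_pow]
  linear_combination (binTerm a q a⁻¹ m * q ^ m * (1 - b * q ^ m)⁻¹) * e +
    binTerm a q a⁻¹ m * Polynomial.eval (q⁻¹ ^ m) Q * (1 - b * q ^ m)⁻¹ * hqm +
    binTerm a q a⁻¹ m * Polynomial.eval (q⁻¹ ^ m) Q * hw

/-! ### `q`-shifted factorials as polynomials and power series -/

/-- The polynomial `(α X; q)_n = ∏_{l < n} (1 - α q ^ l X)`. -/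
noncomputable def qPoly (q α : ℂ) (n : ℕ) : Polynomial ℂ :=
  ∏ l ∈ range n, (1 - Polynomial.C (α * q ^ l) * Polynomial.X)

theorem eval_qPoly (q α u : ℂ) (n : ℕ) : (qPoly q α n).eval u = qPoch (α * u) q n := by
  simp only [qPoly, Polynomial.eval_prod, qPoch_natCast]
  refine prod_congr rfl fun l _ => ?_
  simp
  ring

theorem natDegree_qPoly_le (q α : ℂ) (n : ℕ) : (qPoly q α n).natDegree ≤ n := by
  refine (Polynomial.natDegree_prod_le _ _).trans ?_
  refine (sum_le_card_nsmul _ _ 1 fun l _ => ?_).trans (by simp)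
  compute_degree

/-- The power series expansion of `(X; q)_∞`. -/
noncomputable def qExp (q : ℂ) : PowerSeries ℂ :=
  PowerSeries.mk fun p => ∏ j ∈ range p, (-(q ^ j) / (1 - q ^ (j + 1)))

/-- The formal counterpart of `(X; q)_∞ = (1 - X) (q X; q)_∞`. -/
theorem qExp_eq {q : ℂ} (hq : ‖q‖ < 1) :
    qExp q = (1 - PowerSeries.X) * PowerSeries.rescale q (qExp q) := by
  ext p
  rw [sub_mul, one_mul, map_sub]
  cases p with
  | zero => simp [qExp]
  | succ p =>
    have h : 1 - q ^ (p + 1) ≠ 0 := by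
      rw [pow_succ']
      exact sub_ne_zero.2 (mul_pow_ne_one_of_norm_lt hq hq p).symm
    rw [PowerSeries.coeff_succ_X_mul]
    simp only [PowerSeries.coeff_rescale, qExp, PowerSeries.coeff_mk, prod_range_succ]
    have h' := div_mul_cancel₀ (-(q ^ p)) h
    linear_combination (∏ j ∈ range p, (-(q ^ j) / (1 - q ^ (j + 1)))) * h'

theorem qExp_mul_inv (q : ℂ) : qExp q * (qExp q)⁻¹ = 1 :=
  PowerSeries.mul_inv_cancel _ (by simp [qExp, ← PowerSeries.coeff_zero_eq_constantCoeff_apply])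

/-- The formal counterpart of `(α X; q)_n (α q ^ n X; q)_∞ = (α X; q)_∞`. -/
theorem coe_qPoly_mul {q : ℂ} (hq : ‖q‖ < 1) (α : ℂ) (n : ℕ) :
    (qPoly q α n : PowerSeries ℂ) * PowerSeries.rescale (α * q ^ n) (qExp q) =
      PowerSeries.rescale α (qExp q) := by
  induction n with
  | zero => simp [qPoly]
  | succ n ih =>
    have h := congrArg (PowerSeries.rescale (α * q ^ n)) (qExp_eq hq)
    rw [map_mul, map_sub, map_one, PowerSeries.rescale_X, PowerSeries.rescale_rescale,
      mul_comm q, mul_assoc, ← pow_succ] at h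
    rw [← ih, h, qPoly, prod_range_succ, ← qPoly]
    simp only [Polynomial.coe_mul, Polynomial.coe_sub, Polynomial.coe_one, Polynomial.coe_C,
      Polynomial.coe_X]
    ring

theorem coe_qPoly_eq {q : ℂ} (hq : ‖q‖ < 1) (α : ℂ) (n : ℕ) :
    (qPoly q α n : PowerSeries ℂ) =
      PowerSeries.rescale α (qExp q) * PowerSeries.rescale (α * q ^ n) (qExp q)⁻¹ := by
  rw [← coe_qPoly_mul hq α n, mul_assoc, ← map_mul, qExp_mul_inv, map_one, mul_one]

/-- The `i`-th weight `(q ^ (-s); q)_i / (q; q)_i` of the outer sum. -/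
noncomputable def qWeight (q : ℂ) (s i : ℕ) : ℂ := qPoch (q ^ (-(s : ℤ))) q i / qPoch q q i

/-- The polynomial
`∑_{i ≤ s} (q^{-s})_i / (q)_i q^i (X)_i (β X)_i ∏_j (d_j q^i X)_{n_j - i}` that collects
the inner sums once the order of summation is exchanged. -/
noncomputable def outerPoly {r : ℕ} (q β : ℂ) (d : Fin r → ℂ) (n : Fin r → ℕ) (s : ℕ) :
    Polynomial ℂ :=
  ∑ i ∈ range (s + 1), Polynomial.C (qWeight q s i * q ^ i) *
    (qPoly q 1 i * qPoly q β i * ∏ j, qPoly q (d j * q ^ i) (n j - i))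

/-- The weights annihilate polynomials of degree less than `s` in `q ^ i`: a terminating
instance of the `q`-binomial theorem. -/
theorem sum_qWeight_mul_pow {q : ℂ} (hq0 : q ≠ 0) (hq : ‖q‖ < 1) {s p : ℕ} (hp : p < s) :
    ∑ i ∈ range (s + 1), qWeight q s i * q ^ i * (q ^ i) ^ p = 0 := by
  have hz : ‖q ^ (p + 1)‖ < 1 := by
    rw [norm_pow]; exact pow_lt_one₀ (norm_nonneg _) hq (Nat.succ_ne_zero p)
  have h := tsum_binTerm_eq_zero (a := q ^ (-(s : ℤ))) hq hz (m := s - (p + 1)) (by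
    rw [mul_assoc, ← pow_add, ← zpow_natCast, ← zpow_add₀ hq0,
      show (-(s : ℤ) + ((p + 1 + (s - (p + 1)) : ℕ) : ℤ)) = 0 by omega, zpow_zero])
  rw [tsum_eq_sum (s := range (s + 1))] at h
  · rw [← h]
    refine sum_congr rfl fun i _ => ?_
    rw [binTerm, qWeight, ← pow_mul, ← pow_mul, mul_assoc, ← pow_add]
    congr 2
    ring
  · intro i hi
    have hi' : s < i := by simpa [Nat.lt_succ_iff] using hi
    rw [binTerm, qPoch_eq_zero hi' (by rw [← zpow_natCast, ← zpow_add₀ hq0]; simp)]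
    simp

/-- Every summand of `outerPoly` is, as a power series, `B * A (q ^ i X)` with `A` and `B`
independent of `i`, so the weights kill its coefficients of order less than `s`. -/
theorem X_pow_dvd_outerPoly {r : ℕ} {q : ℂ} (hq0 : q ≠ 0) (hq : ‖q‖ < 1) (β : ℂ)
    (d : Fin r → ℂ) {n : Fin r → ℕ} {s : ℕ} (hs : ∀ j, s ≤ n j) :
    Polynomial.X ^ s ∣ outerPoly q β d n s := by
  set E := qExp q
  set F := (qExp q)⁻¹
  set A : PowerSeries ℂ :=
    F * PowerSeries.rescale β F * ∏ j, PowerSeries.rescale (d j) E with hA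
  set B : PowerSeries ℂ :=
    E * PowerSeries.rescale β E * ∏ j, PowerSeries.rescale (d j * q ^ n j) F with hB
  have hterm : ∀ i ∈ range (s + 1), ((Polynomial.C (qWeight q s i * q ^ i) *
      (qPoly q 1 i * qPoly q β i * ∏ j, qPoly q (d j * q ^ i) (n j - i)) : Polynomial ℂ) :
        PowerSeries ℂ) =
      B * (PowerSeries.C (qWeight q s i * q ^ i) * PowerSeries.rescale (q ^ i) A) := by
    intro i hi
    have hprod : ((∏ j, qPoly q (d j * q ^ i) (n j - i) : Polynomial ℂ) : PowerSeries ℂ) =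
        (∏ j, PowerSeries.rescale (q ^ i) (PowerSeries.rescale (d j) E)) *
          ∏ j, PowerSeries.rescale (d j * q ^ n j) F := by
      rw [← Polynomial.coeToPowerSeries.ringHom_apply, map_prod, ← prod_mul_distrib]
      refine prod_congr rfl fun j _ => ?_
      have hij : i ≤ n j := (Nat.lt_succ_iff.1 (mem_range.1 hi)).trans (hs j)
      rw [Polynomial.coeToPowerSeries.ringHom_apply, coe_qPoly_eq hq, mul_assoc (d j), ← pow_add,
        Nat.add_sub_cancel' hij, PowerSeries.rescale_rescale]
    rw [Polynomial.coe_mul, Polynomial.coe_mul, Polynomial.coe_mul, hprod, Polynomial.coe_C,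
      coe_qPoly_eq hq, coe_qPoly_eq hq, hA, hB]
    simp only [map_mul, map_prod, one_mul, PowerSeries.rescale_one, RingHom.id_apply,
      PowerSeries.rescale_rescale]
    ring
  have hV : (outerPoly q β d n s : PowerSeries ℂ) = B * ∑ i ∈ range (s + 1),
      PowerSeries.C (qWeight q s i * q ^ i) * PowerSeries.rescale (q ^ i) A := by
    rw [outerPoly, ← Polynomial.coeToPowerSeries.ringHom_apply, map_sum, mul_sum]
    exact sum_congr rfl fun i hi => by
      rw [Polynomial.coeToPowerSeries.ringHom_apply, hterm i hi]
  have hdvd : (PowerSeries.X : PowerSeries ℂ) ^ s ∣ (outerPoly q β d n s : PowerSeries ℂ) := by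
    rw [hV]
    refine Dvd.dvd.mul_left (PowerSeries.X_pow_dvd_iff.2 fun p hp => ?_) _
    simp only [map_sum, PowerSeries.coeff_C_mul, PowerSeries.coeff_rescale, ← mul_assoc]
    rw [← sum_mul, sum_qWeight_mul_pow hq0 hq hp, zero_mul]
  rw [Polynomial.X_pow_dvd_iff]
  intro p hp
  rw [← Polynomial.coeff_coe]
  exact PowerSeries.X_pow_dvd_iff.1 hdvd p hp

/-- The `i`-th summand has degree at most `2 i + ∑_j (n_j - i)`; the truncated difference `2 - r` is
intended, since for `r ≥ 2` the maximum over `i` is at `i = 0`. -/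
theorem natDegree_outerPoly_le {r : ℕ} (q β : ℂ) (d : Fin r → ℂ) {n : Fin r → ℕ} {s : ℕ}
    (hs : ∀ j, s ≤ n j) : (outerPoly q β d n s).natDegree ≤ ∑ j, n j + (2 - r) * s := by
  refine Polynomial.natDegree_sum_le_of_forall_le _ _ fun i hi => ?_
  have hi' : i ≤ s := Nat.lt_succ_iff.1 (mem_range.1 hi)
  have h1 : (∏ j, qPoly q (d j * q ^ i) (n j - i)).natDegree ≤ ∑ j, (n j - i) :=
    (Polynomial.natDegree_prod_le _ _).trans (sum_le_sum fun j _ => natDegree_qPoly_le _ _ _)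
  have h2 : ∑ j, (n j - i) + r * i = ∑ j, n j := by
    have : ∑ _j : Fin r, i = r * i := by simp
    rw [← this, ← sum_add_distrib]
    exact sum_congr rfl fun j _ => Nat.sub_add_cancel (hi'.trans (hs j))
  have h3 : 2 * i ≤ r * i + (2 - r) * s := by
    rcases le_total r 2 with h | h
    · calc 2 * i = r * i + (2 - r) * i := by rw [← add_mul, Nat.add_sub_cancel' h]
        _ ≤ _ := by gcongr
    · exact (Nat.mul_le_mul_right i h).trans (Nat.le_add_right _ _)
  refine (Polynomial.natDegree_C_mul_le _ _).trans (Polynomial.natDegree_mul_le.trans ?_)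
  have h4 := Polynomial.natDegree_mul_le (p := qPoly q 1 i) (q := qPoly q β i)
  have h5 := natDegree_qPoly_le q 1 i
  have h6 := natDegree_qPoly_le q β i
  omega

/-! ### Reversal of finite `q`-shifted factorials -/

/-- The factor `(-1) ^ L q ^ (L (L - 1) / 2)` that appears when `(c; q)_L` is reversed. -/
noncomputable def revFactor (q : ℂ) (L : ℕ) : ℂ := ∏ j ∈ range L, (-(q ^ j))

theorem revFactor_ne_zero {q : ℂ} (hq0 : q ≠ 0) (L : ℕ) : revFactor q L ≠ 0 :=
  prod_ne_zero_iff.2 fun j _ => neg_ne_zero.2 (pow_ne_zero j hq0)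

theorem qPoch_reverse {q c : ℂ} (hq0 : q ≠ 0) (hc : c ≠ 0) (L : ℕ) :
    qPoch (q ^ (1 - (L : ℤ)) / c) q L * (revFactor q L * c ^ L) = qPoch c q L := by
  have hcL : c ^ L = ∏ _j ∈ range L, c := by simp
  rw [qPoch_natCast, ← prod_range_reflect, revFactor, hcL, ← prod_mul_distrib,
    ← prod_mul_distrib, qPoch_natCast]
  refine prod_congr rfl fun j hj => ?_
  have hj' : j < L := mem_range.1 hj
  have h : q ^ (1 - (L : ℤ)) * q ^ (L - 1 - j) * q ^ j = 1 := by
    rw [← zpow_natCast, ← zpow_natCast, ← zpow_add₀ hq0, ← zpow_add₀ hq0,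
      show 1 - (L : ℤ) + (L - 1 - j : ℕ) + j = 0 by omega, zpow_zero]
  have hcc := mul_inv_cancel₀ hc
  rw [div_eq_mul_inv]
  linear_combination c * c⁻¹ * h + hcc

/-- Replacing `c` by `c q ^ k` in the reversal of `(c; q)_L`. -/
theorem qPoch_reverse_shift {q c : ℂ} (hq0 : q ≠ 0) (hc : c ≠ 0) (L k : ℕ) :
    qPoch (q ^ (1 - (L : ℤ)) / c) q L * qPoch (c * q ^ L) q k =
      q ^ (k * L) * qPoch (q ^ (1 - (L : ℤ) - k) / c) q L * qPoch c q k := by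
  have h1 := qPoch_reverse hq0 hc L
  have h2 := qPoch_reverse hq0 (mul_ne_zero hc (pow_ne_zero k hq0)) L
  have e : q ^ (1 - (L : ℤ)) / (c * q ^ k) = q ^ (1 - (L : ℤ) - k) / c := by
    rw [zpow_sub₀ hq0 _ (k : ℤ), zpow_natCast, div_div, mul_comm c]
  rw [e, mul_pow, ← pow_mul] at h2
  have h3 := qPoch_add c q L k
  rw [add_comm, qPoch_add, ← h1, ← h2] at h3
  have hne : revFactor q L * c ^ L ≠ 0 := mul_ne_zero (revFactor_ne_zero hq0 L) (pow_ne_zero L hc)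
  refine mul_right_cancel₀ hne ?_
  linear_combination -h3

theorem inv_qPoch_neg {q : ℂ} (hq0 : q ≠ 0) (x : ℂ) (i : ℕ) :
    (qPoch x q (-(i : ℤ)))⁻¹ = qPoch (x * q ^ (-(i : ℤ))) q i := by
  cases i with
  | zero => simp
  | succ i =>
    change (∏ j ∈ range (i + 1), (1 - x * q ^ (-((j : ℤ) + 1))))⁻¹⁻¹ = _
    rw [inv_inv, qPoch_natCast, ← prod_range_reflect]
    refine prod_congr rfl fun j hj => ?_
    have hj' : j < i + 1 := mem_range.1 hj
    rw [mul_assoc, ← zpow_natCast q j, ← zpow_add₀ hq0]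
    congr 3
    omega

/-- The factor `(1 / b)_{1 - i}` is a finite product for `i = 0` and an inverse one for `i ≥ 1`; both
cases are covered by one reversed product. -/
theorem inv_qPoch_one_sub {q b : ℂ} (hq0 : q ≠ 0) (hb : b ≠ 1) (hb0 : b ≠ 0) (i : ℕ) :
    (1 - 1 / b) * (qPoch (1 / b) q (1 - (i : ℤ)))⁻¹ = qPoch (q ^ (1 - (i : ℤ)) / b) q i := by
  have h1b : 1 - 1 / b ≠ 0 := sub_ne_zero.2 fun h => hb (by field_simp at h; exact h)
  cases i with
  | zero =>
    have : qPoch (1 / b) q (1 - ((0 : ℕ) : ℤ)) = 1 - 1 / b :=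
      (qPoch_natCast (1 / b) q 1).trans (by simp)
    rw [this, mul_inv_cancel₀ h1b]
    simp
  | succ i =>
    have e1 : 1 / b * q ^ (-(i : ℤ)) = q ^ (-(i : ℤ)) / b := by ring
    have e2 : q ^ (-(i : ℤ)) / b * q ^ i = 1 / b := by
      rw [div_mul_eq_mul_div, ← zpow_natCast, ← zpow_add₀ hq0, neg_add_cancel, zpow_zero]
    rw [show (1 - ((i + 1 : ℕ) : ℤ)) = -(i : ℤ) by push_cast; ring, inv_qPoch_neg hq0, qPoch_succ,
      e1, e2, mul_comm]

theorem zpow_one_sub_sub {q : ℂ} (hq0 : q ≠ 0) (i k : ℕ) :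
    q ^ (1 - (i : ℤ) - k) = q * q⁻¹ ^ (k + i) := by
  rw [inv_pow, ← zpow_natCast, ← zpow_neg, ← zpow_one_add₀ hq0]
  congr 1
  push_cast
  ring

/-! ### Exchanging the two summations -/

theorem qPochInf_mul_qPoch_shift {q a : ℂ} (hq0 : q ≠ 0) (hq : ‖q‖ < 1) (ha : a ≠ 0) (i k : ℕ) :
    qPochInf (q ^ (1 - (i : ℤ)) / a) q * qPoch (a * q ^ i) q k * (revFactor q i * a ^ i) =
      qPochInf (q / a) q * qPoch a q ((k + i : ℕ) : ℤ) := by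
  have h1 := qPoch_reverse hq0 ha i
  have e : q ^ (1 - (i : ℤ)) / a * q ^ (i : ℤ) = q / a := by
    rw [div_mul_eq_mul_div, ← zpow_add₀ hq0, sub_add_cancel, zpow_one]
  rw [qPochInf_split hq _ i, e, add_comm k, qPoch_add, ← h1]
  ring

theorem qPoch_self_add {q : ℂ} (hq0 : q ≠ 0) (i k : ℕ) :
    qPoch q q ((k + i : ℕ) : ℤ) =
      qPoch q q k * (qPoch (q⁻¹ ^ (k + i)) q i * (revFactor q i * q ^ ((k + 1) * i))) := by
  have h := qPoch_reverse hq0 (pow_ne_zero (k + 1) hq0) i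
  have e : q ^ (1 - (i : ℤ)) / q ^ (k + 1) = q⁻¹ ^ (k + i) := by
    rw [inv_pow, ← zpow_natCast, ← zpow_natCast, ← zpow_neg, ← zpow_sub₀ hq0]
    congr 1
    push_cast
    ring
  rw [e, ← pow_mul] at h
  rw [h, qPoch_add, ← pow_succ']

/-- The exponents of `q` produced by the reversals add up to `s (k + i) + i`. -/
theorem pow_mul_zpow_exponent {r : ℕ} {q : ℂ} (hq0 : q ≠ 0) {n : Fin r → ℕ} {s i : ℕ}
    (hi : ∀ j, i ≤ n j) (k : ℕ) :
    q ^ (s * i) * q ^ ((k + 1) * i) * q ^ (k * i) * (∏ j, q ^ (k * (n j - i))) *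
      (q ^ (-(∑ j, (n j : ℤ)) + s + ((r : ℤ) - 2) * i)) ^ k = (q ^ s) ^ (k + i) * q ^ i := by
  have h : ((∑ j, k * (n j - i) : ℕ) : ℤ) = k * ((∑ j, (n j : ℤ)) - r * i) := by
    rw [← mul_sum]
    push_cast [Nat.cast_sub (hi _)]
    simp
  rw [prod_pow_eq_pow_sum, ← pow_mul]
  simp only [← zpow_natCast, ← zpow_mul, ← zpow_add₀ hq0]
  rw [h]
  congr 1
  push_cast
  ring

/-- The part of the `(i, k)` term common to the two double sums, rewritten as the term of index
`k + i` of a `q`-binomial series times the value of a polynomial at `q ^ (-(k + i))`. -/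
theorem outer_term_eq {r : ℕ} {q a : ℂ} (hq0 : q ≠ 0) (hq : ‖q‖ < 1) (ha : a ≠ 0)
    {c : Fin r → ℂ} (hc : ∀ (j : Fin r) (k : ℕ), c j * q ^ k ≠ 1) (hc0 : ∀ j, c j ≠ 0)
    {n : Fin r → ℕ} {s i : ℕ} (hi : ∀ j, i ≤ n j) (k : ℕ) :
    qWeight q s i * q ^ (s * i) * (qPochInf (q ^ (1 - (i : ℤ)) / a) q *
        ∏ j, qPoch (q ^ (1 - (n j : ℤ)) / c j) q ((n j : ℤ) - i)) *
      ((qPoch (a * q ^ i) q k * ∏ j, qPoch (c j * q ^ n j) q k) /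
        (qPoch q q k * ∏ j, qPoch (c j * q ^ i) q k)) * q ^ (k * i) *
      (a⁻¹ * q ^ (-(∑ j, (n j : ℤ)) + s + ((r : ℤ) - 2) * i)) ^ k =
    qPochInf (q / a) q * (binTerm a q (a⁻¹ * q ^ s) (k + i) * (qWeight q s i * q ^ i *
      (qPoch (q⁻¹ ^ (k + i)) q i *
        ∏ j, qPoch (q ^ (1 - (n j : ℤ)) / c j * q ^ i * q⁻¹ ^ (k + i)) q ((n j - i : ℕ) : ℤ)))) := by
  have hA := qPochInf_mul_qPoch_shift hq0 hq ha i k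
  have hQ := qPoch_self_add hq0 i k
  have hX := pow_mul_zpow_exponent (s := s) hq0 hi k
  have hci : ∀ j, qPoch (c j * q ^ i) q k ≠ 0 := fun j =>
    qPoch_ne_zero (fun l => by rw [mul_assoc, ← pow_add]; exact hc j (i + l)) k
  -- for each `j`, reverse the product of length `n_j - i` that starts at `c_j q ^ i`
  have hP : (∏ j, qPoch (q ^ (1 - (n j : ℤ)) / c j) q ((n j : ℤ) - i)) *
      ∏ j, qPoch (c j * q ^ n j) q k =
      (∏ j, q ^ (k * (n j - i))) * (∏ j, qPoch (q ^ (1 - (n j : ℤ)) / c j * q ^ i *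
        q⁻¹ ^ (k + i)) q ((n j - i : ℕ) : ℤ)) * ∏ j, qPoch (c j * q ^ i) q k := by
    simp only [← prod_mul_distrib]
    refine prod_congr rfl fun j _ => ?_
    have h := qPoch_reverse_shift hq0 (mul_ne_zero (hc0 j) (pow_ne_zero i hq0)) (n j - i) k
    have e1 : q ^ (1 - ((n j - i : ℕ) : ℤ)) / (c j * q ^ i) = q ^ (1 - (n j : ℤ)) / c j := by
      rw [mul_comm (c j), ← div_div, ← zpow_natCast, ← zpow_sub₀ hq0, Nat.cast_sub (hi j)]
      congr 2
      ring
    have e2 : q ^ (1 - ((n j - i : ℕ) : ℤ) - k) / (c j * q ^ i) =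
        q ^ (1 - (n j : ℤ)) / c j * q ^ i * q⁻¹ ^ (k + i) := by
      have hqi := mul_inv_cancel₀ (pow_ne_zero i hq0)
      rw [zpow_sub₀ hq0 _ (k : ℤ), div_right_comm, e1, zpow_natCast, pow_add, inv_pow, inv_pow,
        div_eq_mul_inv _ (q ^ k)]
      linear_combination -(q ^ (1 - (n j : ℤ)) / c j * (q ^ k)⁻¹) * hqi
    rw [e1, e2, mul_assoc (c j), ← pow_add, Nat.add_sub_cancel' (hi j), Nat.cast_sub (hi j)] at h
    rw [h, Nat.cast_sub (hi j)]
  have h1 := qPoch_self_ne_zero hq k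
  have h2 := qPoch_self_ne_zero hq (k + i)
  have h3 : ∏ j, qPoch (c j * q ^ i) q k ≠ 0 := prod_ne_zero_iff.2 fun j _ => hci j
  have haa : a⁻¹ ^ k * a⁻¹ ^ i * a ^ i = a⁻¹ ^ k := by
    rw [mul_assoc, ← mul_pow, inv_mul_cancel₀ ha, one_pow, mul_one]
  rw [binTerm, mul_pow, mul_pow, pow_add a⁻¹]
  -- from here on the identity is polynomial in the factors, which are made opaque
  generalize qPochInf (q ^ (1 - (i : ℤ)) / a) q = A1 at *
  generalize qPoch (a * q ^ i) q k = A2 at *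
  generalize qPoch a q ((k + i : ℕ) : ℤ) = A3 at *
  generalize qPoch (q⁻¹ ^ (k + i)) q i = U at *
  generalize qPoch q q ((k + i : ℕ) : ℤ) = Qm at *
  generalize qPoch q q k = Qk at *
  generalize (∏ j, qPoch (c j * q ^ i) q k) = Ci at *
  generalize (∏ j, qPoch (c j * q ^ n j) q k) = Cn at *
  generalize (∏ j, qPoch (q ^ (1 - (n j : ℤ)) / c j) q ((n j : ℤ) - i)) = D at *
  generalize (∏ j, qPoch (q ^ (1 - (n j : ℤ)) / c j * q ^ i * q⁻¹ ^ (k + i)) q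
    ((n j - i : ℕ) : ℤ)) = D' at *
  generalize (∏ j, q ^ (k * (n j - i))) = pc at *
  generalize (q ^ (-(∑ j, (n j : ℤ)) + s + ((r : ℤ) - 2) * i)) ^ k = X at *
  generalize q ^ (s * i) = x1 at *
  generalize q ^ ((k + 1) * i) = x2 at *
  generalize q ^ (k * i) = x3 at *
  generalize (q ^ s) ^ (k + i) = x4 at *
  generalize q ^ i = x5 at *
  generalize revFactor q i = ρ at *
  generalize qWeight q s i = ω at *
  generalize a⁻¹ ^ k = ak at *
  generalize a⁻¹ ^ i = ai at *
  generalize a ^ i = a' at *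
  generalize qPochInf (q / a) q = Φ at *
  have hr : Φ * (A3 / Qm * (ak * ai * x4) * (ω * x5 * (U * D'))) =
      Φ * (A3 * (ak * ai * x4) * (ω * x5 * (U * D'))) / Qm := by ring
  have hl : ω * x1 * (A1 * D) * (A2 * Cn / (Qk * Ci)) * x3 * (ak * X) =
      ω * x1 * (A1 * D) * (A2 * Cn) * x3 * (ak * X) / (Qk * Ci) := by ring
  rw [hl, hr, div_eq_div_iff (mul_ne_zero h1 h3) h2]
  linear_combination (ω * x1 * A1 * D * A2 * Cn * x3 * ak * X) * hQ +
    (ω * x1 * A1 * A2 * x3 * ak * X * Qk * U * ρ * x2) * hP +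
    (ω * A1 * A2 * D' * Ci * ak * Qk * U * ρ) * hX +
    (ak * ai * x4 * ω * x5 * U * D' * Qk * Ci) * hA -
    (ω * A1 * A2 * D' * Ci * Qk * U * ρ * x4 * x5) * haa

/-- Summing the shifted series: if the `i`-th series is carried by the indices `m ≥ i` and
its polynomial weight vanishes at the smaller indices, all the series may be added term by term. -/
theorem hasSum_eval_sum_of_shift {q Φ : ℂ} {W : ℕ → ℂ} {P : ℕ → Polynomial ℂ} {S : ℕ → ℂ} {s : ℕ}
    (h0 : ∀ i ∈ range (s + 1), ∀ m < i, (P i).eval (q⁻¹ ^ m) = 0)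
    (h : ∀ i ∈ range (s + 1),
      HasSum (fun k => Φ * (W (k + i) * (P i).eval (q⁻¹ ^ (k + i)))) (S i)) :
    HasSum (fun m => Φ * (W m * (∑ i ∈ range (s + 1), P i).eval (q⁻¹ ^ m)))
      (∑ i ∈ range (s + 1), S i) := by
  have key : ∀ i ∈ range (s + 1), HasSum (fun m => Φ * (W m * (P i).eval (q⁻¹ ^ m))) (S i) := by
    intro i hi
    have := (hasSum_nat_add_iff (f := fun m => Φ * (W m * (P i).eval (q⁻¹ ^ m))) i).1 (h i hi)
    rwa [sum_eq_zero fun m hm => by rw [h0 i hi m (mem_range.1 hm), mul_zero, mul_zero],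
      add_zero] at this
  refine (hasSum_sum key).congr_fun fun m => ?_
  rw [Polynomial.eval_finsetSum, mul_sum, mul_sum]

/-! ### The single series -/

/-- The polynomial `∏_{l < n} (X - c q ^ l) = X ^ n (c / X; q)_n`. Unlike `qPoly`, it allows a
parameter `c = 0` without inverting `c`. -/
noncomputable def qPolyRev (q c : ℂ) (n : ℕ) : Polynomial ℂ :=
  ∏ l ∈ range n, (Polynomial.X - Polynomial.C (c * q ^ l))

theorem eval_qPolyRev {u : ℂ} (hu : u ≠ 0) (q c : ℂ) (n : ℕ) :
    (qPolyRev q c n).eval u = u ^ n * qPoch (c / u) q n := by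
  have : u ^ n = ∏ _l ∈ range n, u := by simp
  rw [qPolyRev, Polynomial.eval_prod, qPoch_natCast, this, ← prod_mul_distrib]
  refine prod_congr rfl fun l _ => ?_
  simp only [Polynomial.eval_sub, Polynomial.eval_X, Polynomial.eval_C]
  field_simp

theorem natDegree_qPolyRev (q c : ℂ) (n : ℕ) : (qPolyRev q c n).natDegree = n := by
  rw [qPolyRev, Polynomial.natDegree_prod_of_monic _ _ fun l _ => Polynomial.monic_X_sub_C _]
  simp only [Polynomial.natDegree_X_sub_C, sum_const, card_range, smul_eq_mul, mul_one]

/-- The polynomial `X ^ s ∏_j X ^ {n_j} (c_j / X; q)_{n_j}`, the weight of the single series. -/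
noncomputable def innerPoly {r : ℕ} (q : ℂ) (c : Fin r → ℂ) (n : Fin r → ℕ) (s : ℕ) :
    Polynomial ℂ :=
  Polynomial.X ^ s * ∏ j, qPolyRev q (c j) (n j)

theorem natDegree_innerPoly_le {r : ℕ} (q : ℂ) (c : Fin r → ℂ) (n : Fin r → ℕ) (s : ℕ) :
    (innerPoly q c n s).natDegree ≤ ∑ j, n j + s := by
  refine Polynomial.natDegree_mul_le.trans ?_
  rw [Polynomial.natDegree_X_pow, add_comm]
  refine Nat.add_le_add_right ((Polynomial.natDegree_prod_le _ _).trans (le_of_eq ?_)) s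
  exact sum_congr rfl fun j _ => natDegree_qPolyRev _ _ _

theorem eval_innerPoly {r : ℕ} {u : ℂ} (hu : u ≠ 0) (q : ℂ) (c : Fin r → ℂ) (n : Fin r → ℕ)
    (s : ℕ) :
    (innerPoly q c n s).eval u = u ^ (∑ j, n j + s) * ∏ j, qPoch (c j / u) q (n j) := by
  rw [innerPoly, Polynomial.eval_mul, Polynomial.eval_prod, Polynomial.eval_pow,
    Polynomial.eval_X]
  simp only [eval_qPolyRev hu]
  rw [prod_mul_distrib, prod_pow_eq_pow_sum, pow_add]
  ring

/-- The quotients `(c q ^ n)_k / (c)_k = (c q ^ k)_n / (c)_n` turn the series into a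
`q`-binomial series with polynomial weight. -/
theorem inner_term_eq {r : ℕ} {q : ℂ} (hq0 : q ≠ 0)
    {c : Fin r → ℂ} (hc : ∀ (j : Fin r) (k : ℕ), c j * q ^ k ≠ 1) (n : Fin r → ℕ) (a : ℂ)
    (s k : ℕ) :
    (qPoch a q k * ∏ j, qPoch (c j * q ^ n j) q k) / (qPoch q q k * ∏ j, qPoch (c j) q k) *
      (a⁻¹ * q ^ (-(∑ j, (n j : ℤ)) - s)) ^ k =
    (∏ j, qPoch (c j) q (n j))⁻¹ *
      (binTerm a q a⁻¹ k * (innerPoly q c n s).eval (q⁻¹ ^ k)) := by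
  have hP : (∏ j, qPoch (c j * q ^ n j) q k) * ∏ j, qPoch (c j) q (n j) =
      (∏ j, qPoch (c j / q⁻¹ ^ k) q (n j)) * ∏ j, qPoch (c j) q k := by
    simp only [← prod_mul_distrib]
    refine prod_congr rfl fun j _ => ?_
    rw [inv_pow, div_inv_eq_mul, mul_comm, ← qPoch_add, add_comm, qPoch_add, mul_comm]
  have h1 : ∏ j, qPoch (c j) q k ≠ 0 := prod_ne_zero_iff.2 fun j _ => qPoch_ne_zero (hc j) k
  have h2 : ∏ j, qPoch (c j) q (n j) ≠ 0 :=
    prod_ne_zero_iff.2 fun j _ => qPoch_ne_zero (hc j) (n j)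
  have hx : (q ^ (-(∑ j, (n j : ℤ)) - s)) ^ k = (q⁻¹ ^ k) ^ (∑ j, n j + s) := by
    rw [← pow_mul, ← zpow_natCast q⁻¹, inv_zpow', ← zpow_natCast, ← zpow_mul]
    congr 1
    push_cast
    ring
  rw [eval_innerPoly (pow_ne_zero k (inv_ne_zero hq0)), binTerm, mul_pow, hx]
  generalize ∏ j, qPoch (c j * q ^ n j) q k = p1 at *
  generalize ∏ j, qPoch (c j / q⁻¹ ^ k) q (n j) = p2 at *
  have hp : p1 * (∏ j, qPoch (c j) q k)⁻¹ = p2 * (∏ j, qPoch (c j) q (n j))⁻¹ := by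
    rw [← div_eq_mul_inv, ← div_eq_mul_inv, div_eq_div_iff h1 h2, hP]
  rw [div_eq_mul_inv, mul_inv]
  linear_combination (qPoch a q k * (qPoch q q k)⁻¹ * a⁻¹ ^ k *
    (q⁻¹ ^ k) ^ (∑ j, n j + s)) * hp

theorem norm_mul_zpow_le {q : ℂ} (hq0 : q ≠ 0) (hq : ‖q‖ < 1) (x : ℂ) {e e' : ℤ} (h : e ≤ e') :
    ‖x * q ^ e'‖ ≤ ‖x * q ^ e‖ := by
  rw [norm_mul, norm_mul, norm_zpow, norm_zpow]
  exact mul_le_mul_of_nonneg_left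
    (zpow_le_zpow_right_of_le_one₀ (norm_pos_iff.2 hq0) hq.le h) (norm_nonneg _)

/-- The weight `innerPoly` has degree at most `N + s`, so that the convergence of the series itself
suffices to sum the monomials separately. -/
theorem phi_eq_zero {r : ℕ} {q a : ℂ} (hq0 : q ≠ 0) (hq : ‖q‖ < 1) (ha : a ≠ 0)
    {c : Fin r → ℂ} (hc : ∀ (j : Fin r) (k : ℕ), c j * q ^ k ≠ 1) (n : Fin r → ℕ) (s : ℕ)
    (hx : ‖a⁻¹ * q ^ (-(∑ j, (n j : ℤ)) - s)‖ < 1) :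
    phi a (fun j => c j * q ^ n j) c q (a⁻¹ * q ^ (-(∑ j, (n j : ℤ)) - s)) = 0 := by
  have hV : ∀ p ∈ (innerPoly q c n s).support, ‖a⁻¹ * q⁻¹ ^ p‖ < 1 := by
    intro p hp
    have hp' := (Polynomial.le_natDegree_of_mem_supp p hp).trans (natDegree_innerPoly_le q c n s)
    rw [inv_pow, ← zpow_natCast, ← zpow_neg]
    refine (norm_mul_zpow_le hq0 hq _ ?_).trans_lt hx
    zify at hp'
    linarith
  have h := (hasSum_binTerm_mul_eval hq0 hq ha _ hV).mul_left (∏ j, qPoch (c j) q (n j))⁻¹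
  rw [mul_zero] at h
  refine HasSum.tsum_eq (h.congr_fun fun k => ?_)
  rw [phiTerm, inner_term_eq hq0 hc]

theorem qPoch_mul_one_sub (b q : ℂ) (k : ℕ) :
    qPoch b q k * (1 - b * q ^ k) = (1 - b) * qPoch (b * q) q k := by
  rw [← qPoch_succ, qPoch_succ']

/-- The quotient `(b)_k / (b q)_k = (1 - b) / (1 - b q ^ k)` supplies the denominator of the
`q`-Gauss sum, and the value of `innerPoly` at `b` supplies the finite products. -/
theorem phi_eq_prod {r : ℕ} {q a b : ℂ} (hq0 : q ≠ 0) (hq : ‖q‖ < 1) (ha : a ≠ 0)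
    {c : Fin r → ℂ} (hc : ∀ (j : Fin r) (k : ℕ), c j * q ^ k ≠ 1) (n : Fin r → ℕ) (s : ℕ)
    (hb0 : b ≠ 0) (hb : ∀ k : ℕ, b * q ^ (k + 1) ≠ 1)
    (hx : ‖a⁻¹ * q ^ (1 - (∑ j, (n j : ℤ)) - s)‖ < 1) :
    phi a (Fin.cons b fun j => c j * q ^ n j : Fin (r + 1) → ℂ)
        (Fin.cons (b * q) c) q (a⁻¹ * q ^ (1 - (∑ j, (n j : ℤ)) - s)) =
      (qPochInf q q * qPochInf (b * q / a) q * ∏ j, qPoch (c j / b) q (n j)) /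
        (qPochInf (q / a) q * qPochInf (b * q) q * ∏ j, qPoch (c j) q (n j)) *
        b ^ ((∑ j, n j) + s) := by
  have hN : (0 : ℤ) ≤ ∑ j, (n j : ℤ) := sum_nonneg fun j _ => Int.natCast_nonneg _
  have haq : ‖a⁻¹ * q‖ < 1 := by
    have := norm_mul_zpow_le hq0 hq a⁻¹ (e := 1 - (∑ j, (n j : ℤ)) - s) (e' := 1) (by linarith)
    rw [zpow_one] at this
    exact this.trans_lt hx
  have hbq : ∀ k : ℕ, b * q * q ^ k ≠ 1 := fun k => by
    rw [mul_assoc, ← pow_succ']; exact hb k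
  have hcn : ∏ j, qPoch (c j) q (n j) ≠ 0 :=
    prod_ne_zero_iff.2 fun j _ => qPoch_ne_zero (hc j) (n j)
  have hqa : qPochInf (q / a) q ≠ 0 := by
    refine qPochInf_ne_zero hq (mul_pow_ne_one_of_norm_lt hq ?_)
    rwa [div_eq_inv_mul]
  have hterm : ∀ k, phiTerm a (Fin.cons b fun j => c j * q ^ n j : Fin (r + 1) → ℂ)
      (Fin.cons (b * q) c) q (a⁻¹ * q ^ (1 - (∑ j, (n j : ℤ)) - s)) k =
      qPoch b q k / qPoch (b * q) q k * q ^ k * ((∏ j, qPoch (c j) q (n j))⁻¹ *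
        (binTerm a q a⁻¹ k * (innerPoly q c n s).eval (q⁻¹ ^ k))) := by
    intro k
    have e : a⁻¹ * q ^ (1 - (∑ j, (n j : ℤ)) - s) =
        q * (a⁻¹ * q ^ (-(∑ j, (n j : ℤ)) - s)) := by
      rw [mul_left_comm, ← zpow_one_add₀ hq0]
      congr 2
      ring
    rw [← inner_term_eq hq0 hc, phiTerm, e, mul_pow q]
    simp only [Fin.prod_univ_succ, Fin.cons_zero, Fin.cons_succ]
    rw [div_eq_mul_inv, div_eq_mul_inv, div_eq_mul_inv]
    simp only [mul_inv]
    ring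
  rcases eq_or_ne b 1 with rfl | hb1
  · -- for `b = 1` only the term `k = 0` survives, and both sides are `1`
    have h0 : phi a (Fin.cons 1 fun j => c j * q ^ n j : Fin (r + 1) → ℂ)
        (Fin.cons (1 * q) c) q (a⁻¹ * q ^ (1 - (∑ j, (n j : ℤ)) - s)) = 1 := by
      rw [phi, tsum_eq_single 0]
      · simp [phiTerm]
      · intro k hk
        rw [hterm, qPoch_eq_zero (Nat.pos_of_ne_zero hk) (by simp)]
        simp
    have hqq : qPochInf q q ≠ 0 := qPochInf_ne_zero hq (mul_pow_ne_one_of_norm_lt hq hq)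
    rw [h0]
    simp only [one_mul, div_one, one_pow, mul_one]
    rw [mul_comm (qPochInf (q / a) q), div_self (mul_ne_zero (mul_ne_zero hqq hqa) hcn)]
  · have hball : ∀ k : ℕ, b * q ^ k ≠ 1 := fun k => by
      cases k with
      | zero => simpa using hb1
      | succ k => exact hb k
    have hdeg := natDegree_innerPoly_le q c n s
    have hV : ‖a⁻¹ * q ^ (1 - ((innerPoly q c n s).natDegree : ℤ))‖ < 1 := by
      refine (norm_mul_zpow_le hq0 hq _ ?_).trans_lt hx
      zify at hdeg
      linarith
    have h := (hasSum_binTerm_mul_eval_div hq0 hq ha hball _ hV haq).mul_left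
      ((1 - b) * (∏ j, qPoch (c j) q (n j))⁻¹)
    have hinf : qPochInf b q = (1 - b) * qPochInf (b * q) q := by
      have := qPochInf_split hq b 1
      rwa [qPoch_natCast, prod_range_one, pow_zero, mul_one, Nat.cast_one, zpow_one] at this
    have h1b : 1 - b ≠ 0 := sub_ne_zero.2 hb1.symm
    have hbqi : qPochInf (b * q) q ≠ 0 := qPochInf_ne_zero hq hbq
    refine (HasSum.tsum_eq (h.congr_fun fun k => ?_)).trans ?_
    · have e : qPoch b q k / qPoch (b * q) q k = (1 - b) * (1 - b * q ^ k)⁻¹ := by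
        rw [← div_eq_mul_inv, div_eq_div_iff (qPoch_ne_zero hbq k)
          (sub_ne_zero.2 (hball k).symm), qPoch_mul_one_sub]
      rw [hterm, e, ← binTerm_mul_pow]
      ring
    · rw [eval_innerPoly hb0, hinf]
      field_simp

/-! ### The `s`-sums -/

/-- The common form of the two double sums after division by `X ^ s`. -/
theorem hasSum_outer {r : ℕ} {q a Φ β : ℂ} (hq0 : q ≠ 0) {d : Fin r → ℂ}
    {n : Fin r → ℕ} {s : ℕ} {S : ℕ → ℂ} {g : ℕ → ℂ} {V : Polynomial ℂ}
    (hV : outerPoly q β d n s = Polynomial.X ^ s * V)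
    (h : ∀ i ∈ range (s + 1), HasSum (fun k => Φ * (binTerm a q (a⁻¹ * q ^ s) (k + i) *
      g (k + i) * (qWeight q s i * q ^ i * (qPoch (q⁻¹ ^ (k + i)) q i *
        qPoch (β * q⁻¹ ^ (k + i)) q i *
        ∏ j, qPoch (d j * q ^ i * q⁻¹ ^ (k + i)) q ((n j - i : ℕ) : ℤ))))) (S i)) :
    HasSum (fun m => Φ * (binTerm a q a⁻¹ m * (V.eval (q⁻¹ ^ m) * g m)))
      (∑ i ∈ range (s + 1), S i) := by
  have heval : ∀ i m, (Polynomial.C (qWeight q s i * q ^ i) *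
      (qPoly q 1 i * qPoly q β i * ∏ j, qPoly q (d j * q ^ i) (n j - i))).eval (q⁻¹ ^ m) =
      qWeight q s i * q ^ i * (qPoch (q⁻¹ ^ m) q i * qPoch (β * q⁻¹ ^ m) q i *
        ∏ j, qPoch (d j * q ^ i * q⁻¹ ^ m) q ((n j - i : ℕ) : ℤ)) := by
    intro i m
    simp only [Polynomial.eval_mul, Polynomial.eval_C, Polynomial.eval_prod, eval_qPoly, one_mul]
  have key := hasSum_eval_sum_of_shift (q := q) (Φ := Φ)
    (W := fun m => binTerm a q (a⁻¹ * q ^ s) m * g m)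
    (P := fun i => Polynomial.C (qWeight q s i * q ^ i) *
      (qPoly q 1 i * qPoly q β i * ∏ j, qPoly q (d j * q ^ i) (n j - i))) (S := S) (s := s)
    (fun i _ m hm => by
      rw [heval, qPoch_eq_zero hm (by rw [← mul_pow, inv_mul_cancel₀ hq0, one_pow])]
      simp)
    (fun i hi => by simpa only [heval] using h i hi)
  rw [← outerPoly, hV] at key
  refine key.congr_fun fun m => ?_
  have hqm : (q ^ s) ^ m * (q⁻¹ ^ m) ^ s = 1 := by
    rw [← pow_mul, ← pow_mul, mul_comm m, ← mul_pow, mul_inv_cancel₀ hq0, one_pow]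
  rw [Polynomial.eval_mul, Polynomial.eval_pow, Polynomial.eval_X, ← binTerm_mul_pow]
  linear_combination -(Φ * binTerm a q a⁻¹ m * V.eval (q⁻¹ ^ m) * g m) * hqm

theorem neg_min_mul_eq (r s : ℕ) : min ((r : ℤ) - 2) 0 * s = -(((2 - r) * s : ℕ) : ℤ) := by
  rw [Nat.cast_mul, ← neg_mul]
  congr 1
  omega

theorem min_mul_le {r s i : ℕ} (hi : i ≤ s) :
    min ((r : ℤ) - 2) 0 * s ≤ ((r : ℤ) - 2) * i := by
  have h1 : min ((r : ℤ) - 2) 0 * s ≤ min ((r : ℤ) - 2) 0 * i :=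
    mul_le_mul_of_nonpos_left (by exact_mod_cast hi) (min_le_right _ _)
  exact h1.trans (mul_le_mul_of_nonneg_right (min_le_left _ _) (Int.natCast_nonneg i))

/-- The degree of the polynomial left after removing the factor `X ^ s`. -/
theorem exists_outerPoly_eq {r : ℕ} {q : ℂ} (hq0 : q ≠ 0) (hq : ‖q‖ < 1) (β : ℂ)
    (d : Fin r → ℂ) {n : Fin r → ℕ} {s : ℕ} (hs : ∀ j, s ≤ n j) :
    ∃ V : Polynomial ℂ, outerPoly q β d n s = Polynomial.X ^ s * V ∧
      (V.natDegree : ℤ) ≤ ∑ j, (n j : ℤ) - s - min ((r : ℤ) - 2) 0 * s := by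
  obtain ⟨V, hV⟩ := X_pow_dvd_outerPoly hq0 hq β d hs
  refine ⟨V, hV, ?_⟩
  have hdeg := natDegree_outerPoly_le q β d hs
  rw [neg_min_mul_eq]
  suffices V.natDegree + s ≤ ∑ j, n j + (2 - r) * s by
    zify at this
    push_cast
    linarith
  rcases eq_or_ne V 0 with rfl | hV0
  · rw [Polynomial.natDegree_zero, zero_add]
    rcases Nat.eq_zero_or_pos r with rfl | hr
    · omega
    · exact ((hs ⟨0, hr⟩).trans (single_le_sum (f := n) (fun j _ => Nat.zero_le _)
        (mem_univ _))).trans (Nat.le_add_right _ _)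
  · rwa [hV, Polynomial.natDegree_X_pow_mul s hV0] at hdeg

/-- The double sum with lower parameter `b`: here `β = q / b`, and the weight left after removing
`X ^ s` is polynomial. -/
theorem outer_sum_eq_zero {r : ℕ} {q a b : ℂ} (hq0 : q ≠ 0) (hq : ‖q‖ < 1) (ha : a ≠ 0)
    {c : Fin r → ℂ} (hc : ∀ (j : Fin r) (k : ℕ), c j * q ^ k ≠ 1) (hc0 : ∀ j, c j ≠ 0)
    {n : Fin r → ℕ} {s : ℕ} (hs : ∀ j, s ≤ n j) (hb0 : b ≠ 0) (hb : ∀ k : ℕ, b * q ^ k ≠ 1)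
    (hx : ‖a⁻¹ * q ^ (-(∑ j, (n j : ℤ)) + s + min ((r : ℤ) - 2) 0 * s)‖ < 1)
    (hsum : ∀ i ∈ range (s + 1),
      Summable (phiTerm (a * q ^ i) (Fin.cons (b * q ^ i) fun j => c j * q ^ n j : Fin (r + 1) → ℂ)
        (Fin.cons b fun j => c j * q ^ i) q
        (a⁻¹ * q ^ (-(∑ j, (n j : ℤ)) + s + ((r : ℤ) - 2) * i)))) :
    ∑ i ∈ range (s + 1), qPoch (q ^ (-(s : ℤ))) q i / qPoch q q i * q ^ (s * i)
        * ((qPochInf (q ^ (1 - (i : ℤ)) / a) q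
              * ∏ j, qPoch (q ^ (1 - (n j : ℤ)) / c j) q ((n j : ℤ) - i))
            / qPoch (q / b) q (-(i : ℤ)))
        * phi (a * q ^ i) (Fin.cons (b * q ^ i) fun j => c j * q ^ n j : Fin (r + 1) → ℂ)
          (Fin.cons b fun j => c j * q ^ i) q
          (a⁻¹ * q ^ (-(∑ j, (n j : ℤ)) + s + ((r : ℤ) - 2) * i)) = 0 := by
  obtain ⟨V, hV, hdeg⟩ := exists_outerPoly_eq hq0 hq (q / b)
    (fun j => q ^ (1 - (n j : ℤ)) / c j) hs
  have hsupp : ∀ p ∈ V.support, ‖a⁻¹ * q⁻¹ ^ p‖ < 1 := by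
    intro p hp
    have hp' : (p : ℤ) ≤ V.natDegree := by exact_mod_cast Polynomial.le_natDegree_of_mem_supp p hp
    rw [inv_pow, ← zpow_natCast, ← zpow_neg]
    exact (norm_mul_zpow_le hq0 hq _ (by linarith)).trans_lt hx
  have h0 := (hasSum_binTerm_mul_eval hq0 hq ha V hsupp).mul_left (qPochInf (q / a) q)
  rw [mul_zero] at h0
  refine HasSum.unique (hasSum_outer (a := a) (Φ := qPochInf (q / a) q) (g := fun _ => 1) hq0 hV
    fun i hi => ?_) (by simpa only [mul_one] using h0)
  have hin : ∀ j, i ≤ n j := fun j => (Nat.lt_succ_iff.1 (mem_range.1 hi)).trans (hs j)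
  refine ((hsum i hi).hasSum.mul_left _).congr_fun fun k => ?_
  have hcom := outer_term_eq (s := s) hq0 hq ha hc hc0 hin k
  have hB : (qPoch (q / b) q (-(i : ℤ)))⁻¹ * qPoch (b * q ^ i) q k =
      q ^ (k * i) * qPoch (q / b * q⁻¹ ^ (k + i)) q i * qPoch b q k := by
    have h := qPoch_reverse_shift hq0 hb0 i k
    rw [zpow_one_sub_sub hq0, zpow_sub₀ hq0, zpow_one] at h
    rw [inv_qPoch_neg hq0, zpow_neg, ← div_eq_mul_inv, div_right_comm, h, div_mul_eq_mul_div]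
  have hbk := mul_inv_cancel₀ (qPoch_ne_zero hb k)
  rw [phiTerm]
  simp only [Fin.prod_univ_succ, Fin.cons_zero, Fin.cons_succ]
  rw [qWeight] at hcom ⊢
  set R := qPoch (q ^ (-(s : ℤ))) q i / qPoch q q i * q ^ (s * i) *
    (qPochInf (q ^ (1 - (i : ℤ)) / a) q *
      ∏ j, qPoch (q ^ (1 - (n j : ℤ)) / c j) q ((n j : ℤ) - i)) *
    ((qPoch (a * q ^ i) q k * ∏ j, qPoch (c j * q ^ n j) q k) /
      (qPoch q q k * ∏ j, qPoch (c j * q ^ i) q k)) *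
    (a⁻¹ * q ^ (-(∑ j, (n j : ℤ)) + s + ((r : ℤ) - 2) * i)) ^ k with hR
  have hcom' : R * q ^ (k * i) = _ := Eq.trans (by rw [hR]; ring) hcom
  -- separate the factors that involve `b`
  have hl : ∀ ω A D Bi A2 B2 Cn Qk Bk Ci x : ℂ,
      ω * (A * D / Bi) * (A2 * (B2 * Cn) / (Qk * (Bk * Ci)) * x) =
        ω * (A * D) * (A2 * Cn / (Qk * Ci)) * x * (Bi⁻¹ * B2 * Bk⁻¹) := by
    intros
    rw [div_eq_mul_inv, div_eq_mul_inv, div_eq_mul_inv]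
    simp only [mul_inv]
    ring
  rw [hl, ← hR, hB]
  linear_combination -(qPoch (q / b * q⁻¹ ^ (k + i)) q i) * hcom' -
    (R * q ^ (k * i) * qPoch (q / b * q⁻¹ ^ (k + i)) q i) * hbk

/-- The factors depending on `b` in the double sum whose lower parameter is `b q`. -/
theorem qPoch_outer_factor {q b : ℂ} (hq0 : q ≠ 0) (hb0 : b ≠ 0) (hb : ∀ k : ℕ, b * q ^ k ≠ 1)
    (i k : ℕ) :
    (qPoch (1 / b) q (1 - (i : ℤ)))⁻¹ * qPoch (b * q ^ i) q k * (qPoch (b * q) q k)⁻¹ * q ^ k =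
      -b * q ^ (k * i) * (q ^ (k + i) * (1 - b * q ^ (k + i))⁻¹) *
        qPoch (1 / b * q⁻¹ ^ (k + i)) q i := by
  have hb1 : b ≠ 1 := by simpa using hb 0
  have hbq : qPoch (b * q) q k ≠ 0 :=
    qPoch_ne_zero (fun l => by rw [mul_assoc, ← pow_succ']; exact hb (l + 1)) k
  have h1 := inv_qPoch_one_sub hq0 hb1 hb0 i
  have h2 := qPoch_reverse_shift hq0 hb0 i k
  have h3 := qPoch_mul_one_sub b q k
  have h4 := qPoch_mul_one_sub (1 / b * q⁻¹ ^ (k + i)) q i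
  have e : 1 / b * q⁻¹ ^ (k + i) * q = q ^ (1 - (i : ℤ) - k) / b := by
    rw [zpow_one_sub_sub hq0]
    ring
  rw [e] at h4
  rw [← h1] at h2
  have hbb := mul_inv_cancel₀ hb0
  have hqk : q⁻¹ ^ k * q ^ k = 1 := by rw [← mul_pow, inv_mul_cancel₀ hq0, one_pow]
  have hqi : q⁻¹ ^ i * q ^ i = 1 := by rw [← mul_pow, inv_mul_cancel₀ hq0, one_pow]
  have hm : 1 - b * q ^ (k + i) ≠ 0 := sub_ne_zero.2 (hb (k + i)).symm
  have h1b : 1 - b ≠ 0 := sub_ne_zero.2 hb1.symm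
  rw [pow_add q⁻¹] at h4 ⊢
  rw [pow_add q] at hm ⊢
  rw [one_div] at h2 h4 ⊢
  generalize qPoch (q ^ (1 - (i : ℤ) - k) / b) q i = T at *
  generalize qPoch (b⁻¹ * (q⁻¹ ^ k * q⁻¹ ^ i)) q i = T' at *
  generalize (qPoch b⁻¹ q (1 - (i : ℤ)))⁻¹ = Z at *
  generalize qPoch (b * q ^ i) q k = B2 at *
  generalize qPoch (b * q) q k = B3 at *
  generalize qPoch b q k = B1 at *
  generalize q ^ (k * i) = x3 at *
  generalize q ^ k = y at *
  generalize q ^ i = w at *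
  generalize q⁻¹ ^ k = y' at *
  generalize q⁻¹ ^ i = w' at *
  -- `h4` cleared of the inverses of `b` and of the powers of `q`
  have hT : (1 - b * (y * w)) * T = T' * w * (1 - b * y) := by
    linear_combination (b * y * w) * h4 + (y * w * y' * w' * (w * T' - T)) * hbb +
      (w * w' * (w * T' - T)) * hqk + (w * T' - T) * hqi
  have key : Z * B2 * y * (1 - b * (y * w)) = -b * x3 * (y * w) * T' * B3 := by
    refine mul_left_cancel₀ h1b ?_
    linear_combination (-b * y * (1 - b * (y * w))) * h2 - (b * x3 * B1 * y) * hT -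
      (b * x3 * y * w * T') * h3 - (y * (1 - b * (y * w)) * Z * B2) * hbb
  have hl : Z * B2 * B3⁻¹ * y = Z * B2 * y / B3 := by ring
  have hr : -b * x3 * (y * w * (1 - b * (y * w))⁻¹) * T' =
      -b * x3 * (y * w) * T' / (1 - b * (y * w)) := by ring
  rw [hl, hr, div_eq_div_iff hbq hm, key]

/-- The double sum with lower parameter `b q`: here `β = 1 / b`, and one denominator `1 - b q ^ m`
remains. -/
theorem outer_sum_eq_prod {r : ℕ} {q a b : ℂ} (hq0 : q ≠ 0) (hq : ‖q‖ < 1) (ha : a ≠ 0)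
    {c : Fin r → ℂ} (hc : ∀ (j : Fin r) (k : ℕ), c j * q ^ k ≠ 1) (hc0 : ∀ j, c j ≠ 0)
    {n : Fin r → ℕ} {s : ℕ} (hs : ∀ j, s ≤ n j) (hb0 : b ≠ 0) (hb : ∀ k : ℕ, b * q ^ k ≠ 1)
    (hx : ‖a⁻¹ * q ^ (1 - (∑ j, (n j : ℤ)) + s + min ((r : ℤ) - 2) 0 * s)‖ < 1)
    (hsum : ∀ i ∈ range (s + 1),
      Summable (phiTerm (a * q ^ i) (Fin.cons (b * q ^ i) fun j => c j * q ^ n j : Fin (r + 1) → ℂ)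
        (Fin.cons (b * q) fun j => c j * q ^ i) q
        (a⁻¹ * q ^ (1 - (∑ j, (n j : ℤ)) + s + ((r : ℤ) - 2) * i)))) :
    ∑ i ∈ range (s + 1), qPoch (q ^ (-(s : ℤ))) q i / qPoch q q i * q ^ (s * i)
        * ((qPochInf (q ^ (1 - (i : ℤ)) / a) q
              * ∏ j, qPoch (q ^ (1 - (n j : ℤ)) / c j) q ((n j : ℤ) - i))
            / (qPochInf q q * qPoch (1 / b) q (1 - (i : ℤ))))
        * phi (a * q ^ i) (Fin.cons (b * q ^ i) fun j => c j * q ^ n j : Fin (r + 1) → ℂ)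
          (Fin.cons (b * q) fun j => c j * q ^ i) q
          (a⁻¹ * q ^ (1 - (∑ j, (n j : ℤ)) + s + ((r : ℤ) - 2) * i)) =
      -((qPochInf (b * q / a) q * ∏ j, qPoch (b * q ^ (1 - (n j : ℤ)) / c j) q (n j))
            / qPochInf b q * b ^ (1 - (s : ℤ))) := by
  obtain ⟨V, hV, hdeg⟩ := exists_outerPoly_eq hq0 hq (1 / b)
    (fun j => q ^ (1 - (n j : ℤ)) / c j) hs
  have hVx : ‖a⁻¹ * q ^ (1 - (V.natDegree : ℤ))‖ < 1 :=
    (norm_mul_zpow_le hq0 hq _ (by linarith)).trans_lt hx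
  have haq : ‖a⁻¹ * q‖ < 1 := by
    have h0 : (0 : ℤ) ≤ V.natDegree := Int.natCast_nonneg _
    have := norm_mul_zpow_le hq0 hq a⁻¹ (e' := 1)
      (e := 1 - (∑ j, (n j : ℤ)) + s + min ((r : ℤ) - 2) 0 * s) (by linarith)
    rw [zpow_one] at this
    exact this.trans_lt hx
  have hqa : qPochInf (q / a) q ≠ 0 := by
    refine qPochInf_ne_zero hq (mul_pow_ne_one_of_norm_lt hq ?_)
    rwa [div_eq_inv_mul]
  have hqq : qPochInf q q ≠ 0 := qPochInf_ne_zero hq (mul_pow_ne_one_of_norm_lt hq hq)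
  have hbi : qPochInf b q ≠ 0 := qPochInf_ne_zero hq hb
  -- at `X = b` every summand of `outerPoly` with `i ≥ 1` contains the factor `1 - X / b`
  have hVb : b ^ s * V.eval b = ∏ j, qPoch (b * q ^ (1 - (n j : ℤ)) / c j) q (n j) := by
    have h := congrArg (Polynomial.eval b) hV
    rw [Polynomial.eval_mul, Polynomial.eval_pow, Polynomial.eval_X] at h
    rw [← h, outerPoly, Polynomial.eval_finsetSum, sum_eq_single 0]
    · simp only [Polynomial.eval_mul, Polynomial.eval_C, Polynomial.eval_prod, eval_qPoly,
        qWeight, Nat.cast_zero, qPoch_zero, pow_zero, mul_one, div_one, one_mul, Nat.sub_zero]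
      exact prod_congr rfl fun j _ => by congr 1; ring
    · intro i _ hi
      simp only [Polynomial.eval_mul, eval_qPoly]
      rw [qPoch_eq_zero (a := 1 / b * b) (Nat.pos_of_ne_zero hi)
        (by rw [pow_zero, mul_one, one_div, inv_mul_cancel₀ hb0])]
      simp
    · simp
  have h0 := (hasSum_binTerm_mul_eval_div hq0 hq ha hb V hVx haq).mul_left
    (qPochInf (q / a) q / qPochInf q q * -b)
  have hS := hasSum_outer (a := a) (Φ := qPochInf (q / a) q / qPochInf q q * -b)
    (g := fun m => q ^ m * (1 - b * q ^ m)⁻¹) hq0 hV fun i hi => by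
      have hin : ∀ j, i ≤ n j := fun j => (Nat.lt_succ_iff.1 (mem_range.1 hi)).trans (hs j)
      refine ((hsum i hi).hasSum.mul_left (qPoch (q ^ (-(s : ℤ))) q i / qPoch q q i * q ^ (s * i)
        * ((qPochInf (q ^ (1 - (i : ℤ)) / a) q
              * ∏ j, qPoch (q ^ (1 - (n j : ℤ)) / c j) q ((n j : ℤ) - i))
            / (qPochInf q q * qPoch (1 / b) q (1 - (i : ℤ)))))).congr_fun fun k => ?_
      have hcom := outer_term_eq (s := s) hq0 hq ha hc hc0 hin k
      have hB := qPoch_outer_factor hq0 hb0 hb i k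
      have e : a⁻¹ * q ^ (1 - (∑ j, (n j : ℤ)) + s + ((r : ℤ) - 2) * i) =
          q * (a⁻¹ * q ^ (-(∑ j, (n j : ℤ)) + s + ((r : ℤ) - 2) * i)) := by
        rw [mul_left_comm, ← zpow_one_add₀ hq0]
        congr 2
        ring
      rw [phiTerm, e, mul_pow q]
      simp only [Fin.prod_univ_succ, Fin.cons_zero, Fin.cons_succ]
      rw [qWeight] at hcom ⊢
      set R := qPoch (q ^ (-(s : ℤ))) q i / qPoch q q i * q ^ (s * i) *
        (qPochInf (q ^ (1 - (i : ℤ)) / a) q *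
          ∏ j, qPoch (q ^ (1 - (n j : ℤ)) / c j) q ((n j : ℤ) - i)) *
        ((qPoch (a * q ^ i) q k * ∏ j, qPoch (c j * q ^ n j) q k) /
          (qPoch q q k * ∏ j, qPoch (c j * q ^ i) q k)) *
        (a⁻¹ * q ^ (-(∑ j, (n j : ℤ)) + s + ((r : ℤ) - 2) * i)) ^ k with hR
      have hcom' : R * q ^ (k * i) = _ := Eq.trans (by rw [hR]; ring) hcom
      -- separate the factors that involve `b`
      have hl : ∀ ω A D q' Bi A2 B2 Cn Qk Bk Ci y x : ℂ,
          ω * (A * D / (q' * Bi)) * (A2 * (B2 * Cn) / (Qk * (Bk * Ci)) * (y * x)) =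
            ω * (A * D) * (A2 * Cn / (Qk * Ci)) * x * q'⁻¹ * (Bi⁻¹ * B2 * Bk⁻¹ * y) := by
        intros
        rw [div_eq_mul_inv, div_eq_mul_inv, div_eq_mul_inv]
        simp only [mul_inv]
        ring
      rw [hl, ← hR, hB]
      linear_combination ((qPochInf q q)⁻¹ * b * (q ^ (k + i) * (1 - b * q ^ (k + i))⁻¹) *
        qPoch (1 / b * q⁻¹ ^ (k + i)) q i) * hcom'
  refine (hS.unique (h0.congr_fun fun m => ?_)).trans ?_
  · rw [← binTerm_mul_pow]
    ring
  · rw [← hVb, zpow_sub₀ hb0, zpow_one, zpow_natCast]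
    have hbs : b ^ s ≠ 0 := pow_ne_zero s hb0
    field_simp

end BasicHyp

theorem mainTheorem5 (q : ℂ) (hq0 : q ≠ 0) (hq1 : ‖q‖ < 1)
    (r s : ℕ) (n : Fin r → ℕ) (a b : ℂ) (c : Fin r → ℂ) (ha : a ≠ 0)
    (hc : ∀ (j : Fin r) (k : ℕ), c j * q ^ k ≠ 1) :
    -- the evaluation of a single series as a product
    (b ≠ 0 → (∀ k : ℕ, b * q ^ (k + 1) ≠ 1) →
      ‖a⁻¹ * q ^ (1 - (∑ j, (n j : ℤ)) - s)‖ < 1 →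
      Summable (BasicHyp.phiTerm a (Fin.cons b fun j => c j * q ^ n j : Fin (r + 1) → ℂ)
        (Fin.cons (b * q) c) q (a⁻¹ * q ^ (1 - (∑ j, (n j : ℤ)) - s))) ∧
      BasicHyp.phi a (Fin.cons b fun j => c j * q ^ n j : Fin (r + 1) → ℂ)
        (Fin.cons (b * q) c) q (a⁻¹ * q ^ (1 - (∑ j, (n j : ℤ)) - s))
      = (BasicHyp.qPochInf q q * BasicHyp.qPochInf (b * q / a) q
            * ∏ j, BasicHyp.qPoch (c j / b) q (n j))
          / (BasicHyp.qPochInf (q / a) q * BasicHyp.qPochInf (b * q) q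
            * ∏ j, BasicHyp.qPoch (c j) q (n j))
          * b ^ ((∑ j, n j) + s)) ∧
    -- the `s`-sum with a product on the right
    (b ≠ 0 → (∀ k : ℕ, b * q ^ k ≠ 1) → (∀ j, c j ≠ 0) →
      ‖a⁻¹ * q ^ (1 - (∑ j, (n j : ℤ)) + s + min ((r : ℤ) - 2) 0 * s)‖ < 1 →
      (∀ j, s ≤ n j) →
      (∀ i ∈ Finset.range (s + 1),
        Summable (BasicHyp.phiTerm (a * q ^ i)
          (Fin.cons (b * q ^ i) fun j => c j * q ^ n j : Fin (r + 1) → ℂ)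
          (Fin.cons (b * q) fun j => c j * q ^ i) q
          (a⁻¹ * q ^ (1 - (∑ j, (n j : ℤ)) + s + ((r : ℤ) - 2) * i)))) ∧
      ∑ i ∈ Finset.range (s + 1),
        BasicHyp.qPoch (q ^ (-(s : ℤ))) q i / BasicHyp.qPoch q q i * q ^ (s * i)
        * ((BasicHyp.qPochInf (q ^ (1 - (i : ℤ)) / a) q
              * ∏ j, BasicHyp.qPoch (q ^ (1 - (n j : ℤ)) / c j) q ((n j : ℤ) - i))
            / (BasicHyp.qPochInf q q * BasicHyp.qPoch (1 / b) q (1 - (i : ℤ))))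
        * BasicHyp.phi (a * q ^ i)
          (Fin.cons (b * q ^ i) fun j => c j * q ^ n j : Fin (r + 1) → ℂ)
          (Fin.cons (b * q) fun j => c j * q ^ i) q
          (a⁻¹ * q ^ (1 - (∑ j, (n j : ℤ)) + s + ((r : ℤ) - 2) * i))
      = -((BasicHyp.qPochInf (b * q / a) q
              * ∏ j, BasicHyp.qPoch (b * q ^ (1 - (n j : ℤ)) / c j) q (n j))
            / BasicHyp.qPochInf b q * b ^ (1 - (s : ℤ)))) ∧
    -- the vanishing of a single series
    (‖a⁻¹ * q ^ (-(∑ j, (n j : ℤ)) - s)‖ < 1 →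
      Summable (BasicHyp.phiTerm a (fun j => c j * q ^ n j) c q
        (a⁻¹ * q ^ (-(∑ j, (n j : ℤ)) - s))) ∧
      BasicHyp.phi a (fun j => c j * q ^ n j) c q (a⁻¹ * q ^ (-(∑ j, (n j : ℤ)) - s)) = 0) ∧
    -- the vanishing of the `s`-sum
    (b ≠ 0 → (∀ k : ℕ, b * q ^ k ≠ 1) → (∀ j, c j ≠ 0) →
      ‖a⁻¹ * q ^ (-(∑ j, (n j : ℤ)) + s + min ((r : ℤ) - 2) 0 * s)‖ < 1 →
      (∀ j, s ≤ n j) →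
      (∀ i ∈ Finset.range (s + 1),
        Summable (BasicHyp.phiTerm (a * q ^ i)
          (Fin.cons (b * q ^ i) fun j => c j * q ^ n j : Fin (r + 1) → ℂ)
          (Fin.cons b fun j => c j * q ^ i) q
          (a⁻¹ * q ^ (-(∑ j, (n j : ℤ)) + s + ((r : ℤ) - 2) * i)))) ∧
      ∑ i ∈ Finset.range (s + 1),
        BasicHyp.qPoch (q ^ (-(s : ℤ))) q i / BasicHyp.qPoch q q i * q ^ (s * i)
        * ((BasicHyp.qPochInf (q ^ (1 - (i : ℤ)) / a) q
              * ∏ j, BasicHyp.qPoch (q ^ (1 - (n j : ℤ)) / c j) q ((n j : ℤ) - i))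
            / BasicHyp.qPoch (q / b) q (-(i : ℤ)))
        * BasicHyp.phi (a * q ^ i)
          (Fin.cons (b * q ^ i) fun j => c j * q ^ n j : Fin (r + 1) → ℂ)
          (Fin.cons b fun j => c j * q ^ i) q
          (a⁻¹ * q ^ (-(∑ j, (n j : ℤ)) + s + ((r : ℤ) - 2) * i))
      = 0) := by
  have shift_ne : ∀ (i : ℕ) (j : Fin r) (k : ℕ), c j * q ^ i * q ^ k ≠ 1 := fun i j k => by
    rw [mul_assoc, ← pow_add]
    exact hc j (i + k)
  refine ⟨fun hb0 hb hx => ⟨?_, BasicHyp.phi_eq_prod hq0 hq1 ha hc n s hb0 hb hx⟩,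
    fun hb0 hb hc0 hx hs => ?_,
    fun hx => ⟨BasicHyp.summable_phiTerm hq1 hx hc, BasicHyp.phi_eq_zero hq0 hq1 ha hc n s hx⟩,
    fun hb0 hb hc0 hx hs => ?_⟩
  · refine BasicHyp.summable_phiTerm hq1 hx fun j => ?_
    refine Fin.cases (fun k => ?_) (fun j => hc j) j
    rw [Fin.cons_zero, mul_assoc, ← pow_succ']
    exact hb k
  · have hsum := fun i (hi : i ∈ Finset.range (s + 1)) =>
      BasicHyp.summable_phiTerm (a := a * q ^ i)
        (b := (Fin.cons (b * q ^ i) fun j => c j * q ^ n j : Fin (r + 1) → ℂ))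
        (c := Fin.cons (b * q) fun j => c j * q ^ i) hq1
        ((BasicHyp.norm_mul_zpow_le hq0 hq1 a⁻¹ (add_le_add_right (BasicHyp.min_mul_le
          (Nat.lt_succ_iff.1 (Finset.mem_range.1 hi))) (1 - (∑ j, (n j : ℤ)) + s))).trans_lt hx)
        fun j => by
          refine Fin.cases (fun k => ?_) (fun j => shift_ne i j) j
          rw [Fin.cons_zero, mul_assoc, ← pow_succ']
          exact hb (k + 1)
    exact ⟨hsum, BasicHyp.outer_sum_eq_prod hq0 hq1 ha hc hc0 hs hb0 hb hx hsum⟩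
  · have hsum := fun i (hi : i ∈ Finset.range (s + 1)) =>
      BasicHyp.summable_phiTerm (a := a * q ^ i)
        (b := (Fin.cons (b * q ^ i) fun j => c j * q ^ n j : Fin (r + 1) → ℂ))
        (c := Fin.cons b fun j => c j * q ^ i) hq1
        ((BasicHyp.norm_mul_zpow_le hq0 hq1 a⁻¹ (add_le_add_right (BasicHyp.min_mul_le
          (Nat.lt_succ_iff.1 (Finset.mem_range.1 hi))) (-(∑ j, (n j : ℤ)) + s))).trans_lt hx)
        fun j => Fin.cases hb (fun j => shift_ne i j) j
    exact ⟨hsum, BasicHyp.outer_sum_eq_zero hq0 hq1 ha hc hc0 hs hb0 hb hx hsum⟩
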